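/- **Setting.** An instance of the capacitated assortment problem under the two-stage Luce model (2SLM) consists of products $X=\{1,\dots,n\}$ with attractivenesses $a_i>0$ and revenues $r_i\ge 0$, an outside option of attractiveness $a_0\ge 0$, a strict partial order $\succ$ on $X$ (the dominance relation) and a capacity $C$ with $1\le C\le n$. For $S\subseteq X$ let $c(S)=\{x\in S : \nexists\, y\in S,\ y\succ x\}$, let $\rho(x,S)=a_x/\big(\sum_{y\in c(S)}a_y+a_0\big)$ for $x\in c(S)$ and $\rho(x,S)=0$ otherwise, and let $R(S)=\sum_{i\in c(S)}\rho(i,S)\,r_i$ (so $R(\emptyset)=0$). A set is dominance-free if no product in it dominates another. The problem is to maximize $R(S)$ over the dominance-free sets $S$ with $|S|\le C$; for these $R(S)=R_{\mathrm{MNL}}(S):=\sum_{i\in S}r_ia_i\big/\big(\sum_{i\in S}a_i+a_0\big)$. The dominance relation is attractiveness-correlated if (1) $x\succ y$ implies $a_x>a_y$, and (2) $x\succ y$ and $a_z>a_x$ imply $z\succ y$. Assume also that equally attractive products dominate the same products: $x\succ y$ and $a_z=a_x$ imply $z\succ y$ (this is automatic if the attractivenesses are distinct, and in the threshold Luce model,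 where $x\succ y$ iff $a_x>(1+t)a_y$). **Theorem.** The capacitated assortment problem under the 2SLM is solvable in polynomial time on the instances whose dominance relation is attractiveness-correlated and in which equally attractive products dominate the same products. More precisely, there is one random access machine program (using on the numerical data only the constants $0,1$, the operations $+,-,\times,/$ and comparisons) which returns an optimal assortment for every such instance, and which * for real data, with unit cost per operation on the numerical data (and logarithmic cost for integers), runs in time polynomial in $n$; * for rational data, with logarithmic (bit) cost for all operations, runs in time polynomial in the number of bits of the instance. Moreover, for every such instance (with real data) put $X_k=\{i\in X : a_i\le a_k,\ k\not\succ i\}$ for $k=1,\dots,n$. Then: * every $X_k$ is dominance-free, and $R(S)=R_{\mathrm{MNL}}(S)$ for every $S\subseteq X_k$; * an optimal assortment exists, and every optimal assortment is contained in some $X_k$; * the problem reduces to $n$ capacitated multinomial logit problems: if for each $k$ the set $S_k$ maximizes $R_{\mathrm{MNL}}(S)$ over all $S\subseteq X_k$ with $|S|\le C$, then any $S_k$ with the largest value $R_{\mathrm{MNL}}(S_k)$ among $S_1,\dots,S_n$ is an optimal assortment. -/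

import Mathlib

/-! ## A random access machine, as a small imperative language with a cost measure

A store consists of natural-number variables and arrays, and of variables and arrays that hold
elements of an ordered field `K` (the numerical data). Field elements can only be added, subtracted,
multiplied, divided and compared; the only constants available are `0` and `1`. -/

namespace RAM

/-- Expressions with natural-number values (`sub` is truncated). -/
inductive NatExpr where
  | const (c : ℕ)
  | var (x : ℕ)
  | get (A : ℕ) (i : NatExpr)
  | add (e f : NatExpr)
  | sub (e f : NatExpr)
  | mul (e f : NatExpr)

/-- Expressions with values in the ordered field. -/
inductive NumExpr where
  | zero
  | one
  | var (x : ℕ)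
  | get (A : ℕ) (i : NatExpr)
  | add (e f : NumExpr)
  | sub (e f : NumExpr)
  | mul (e f : NumExpr)
  | div (e f : NumExpr)

/-- Tests. -/
inductive Test where
  | natLt (e f : NatExpr)
  | numLt (e f : NumExpr)
  | not (b : Test)
  | and (b c : Test)

/-- Programs. -/
inductive Prog where
  | skip
  | setNat (x : ℕ) (e : NatExpr)
  | setNum (x : ℕ) (e : NumExpr)
  | putNat (A : ℕ) (i e : NatExpr)
  | putNum (A : ℕ) (i : NatExpr) (e : NumExpr)
  | seq (P Q : Prog)
  | ite (b : Test) (P Q : Prog)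
  | loop (b : Test) (P : Prog)

/-- The memory: variables and (unbounded) arrays of both sorts. -/
structure Store (K : Type) where
  nat : ℕ → ℕ
  natArr : ℕ → ℕ → ℕ
  num : ℕ → K
  numArr : ℕ → ℕ → K

section
variable {K : Type}

/-- Value of a natural-number expression. -/
def NatExpr.val (s : Store K) : NatExpr → ℕ
  | .const c => c
  | .var x => s.nat x
  | .get A i => s.natArr A (i.val s)
  | .add e f => e.val s + f.val s
  | .sub e f => e.val s - f.val s
  | .mul e f => e.val s * f.val s

/-- Cost of evaluating a natural-number expression: every node is charged one unit plus the number
of bits of its value (logarithmic cost). -/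
def NatExpr.cost (s : Store K) : NatExpr → ℕ
  | .const c => 1 + Nat.size c
  | .var x => 1 + Nat.size (s.nat x)
  | .get A i => i.cost s + (1 + Nat.size (s.natArr A (i.val s)))
  | .add e f => e.cost s + f.cost s + (1 + Nat.size (e.val s + f.val s))
  | .sub e f => e.cost s + f.cost s + (1 + Nat.size (e.val s - f.val s))
  | .mul e f => e.cost s + f.cost s + (1 + Nat.size (e.val s * f.val s))

/-- Value of a field expression. -/
def NumExpr.val [Field K] (s : Store K) : NumExpr → K
  | .zero => 0
  | .one => 1
  | .var x => s.num x
  | .get A i => s.numArr A (i.val s)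
  | .add e f => e.val s + f.val s
  | .sub e f => e.val s - f.val s
  | .mul e f => e.val s * f.val s
  | .div e f => e.val s / f.val s

/-- Cost of evaluating a field expression: every node is charged one unit plus the size `sz` of its
value. -/
def NumExpr.cost [Field K] (sz : K → ℕ) (s : Store K) : NumExpr → ℕ
  | .zero => 1 + sz 0
  | .one => 1 + sz 1
  | .var x => 1 + sz (s.num x)
  | .get A i => i.cost s + (1 + sz (s.numArr A (i.val s)))
  | .add e f => e.cost sz s + f.cost sz s + (1 + sz (e.val s + f.val s))
  | .sub e f => e.cost sz s + f.cost sz s + (1 + sz (e.val s - f.val s))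
  | .mul e f => e.cost sz s + f.cost sz s + (1 + sz (e.val s * f.val s))
  | .div e f => e.cost sz s + f.cost sz s + (1 + sz (e.val s / f.val s))

/-- Truth of a test. -/
def Test.Holds [Field K] [LinearOrder K] (s : Store K) : Test → Prop
  | .natLt e f => e.val s < f.val s
  | .numLt e f => e.val s < f.val s
  | .not b => ¬ b.Holds s
  | .and b c => b.Holds s ∧ c.Holds s

/-- Cost of evaluating a test. -/
def Test.cost [Field K] (sz : K → ℕ) (s : Store K) : Test → ℕ
  | .natLt e f => e.cost s + f.cost s + 1
  | .numLt e f => e.cost sz s + f.cost sz s + 1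
  | .not b => b.cost sz s + 1
  | .and b c => b.cost sz s + c.cost sz s + 1

/-- `Exec sz P s s' t`: the program `P`, started in the store `s`, halts in the store `s'` at total
cost `t`. -/
inductive Exec [Field K] [LinearOrder K] (sz : K → ℕ) : Prog → Store K → Store K → ℕ → Prop
  | skip (s : Store K) : Exec sz .skip s s 1
  | setNat (x : ℕ) (e : NatExpr) (s : Store K) :
      Exec sz (.setNat x e) s { s with nat := Function.update s.nat x (e.val s) } (e.cost s + 1)
  | setNum (x : ℕ) (e : NumExpr) (s : Store K) :
      Exec sz (.setNum x e) s { s with num := Function.update s.num x (e.val s) } (e.cost sz s + 1)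
  | putNat (A : ℕ) (i e : NatExpr) (s : Store K) :
      Exec sz (.putNat A i e) s
        { s with natArr :=
            Function.update s.natArr A (Function.update (s.natArr A) (i.val s) (e.val s)) }
        (i.cost s + e.cost s + 1)
  | putNum (A : ℕ) (i : NatExpr) (e : NumExpr) (s : Store K) :
      Exec sz (.putNum A i e) s
        { s with numArr :=
            Function.update s.numArr A (Function.update (s.numArr A) (i.val s) (e.val s)) }
        (i.cost s + e.cost sz s + 1)
  | seq {P Q : Prog} {s s' s'' : Store K} {t u : ℕ} :
      Exec sz P s s' t → Exec sz Q s' s'' u → Exec sz (.seq P Q) s s'' (t + u)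
  | iteTrue {b : Test} {P Q : Prog} {s s' : Store K} {t : ℕ} :
      b.Holds s → Exec sz P s s' t → Exec sz (.ite b P Q) s s' (b.cost sz s + t)
  | iteFalse {b : Test} {P Q : Prog} {s s' : Store K} {t : ℕ} :
      ¬ b.Holds s → Exec sz Q s s' t → Exec sz (.ite b P Q) s s' (b.cost sz s + t)
  | loopDone {b : Test} {P : Prog} {s : Store K} :
      ¬ b.Holds s → Exec sz (.loop b P) s s (b.cost sz s)
  | loopStep {b : Test} {P : Prog} {s s' s'' : Store K} {t u : ℕ} :
      b.Holds s → Exec sz P s s' t → Exec sz (.loop b P) s' s'' u →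
      Exec sz (.loop b P) s s'' (b.cost sz s + t + u)

end

/-- Unit cost: every field element has size one (arithmetic model). -/
def unitSize {K : Type} (_ : K) : ℕ := 1

/-- Bit cost: the size of a rational number is the number of bits of its numerator and its
denominator in lowest terms. -/
def bitSize (q : ℚ) : ℕ := Nat.size q.num.natAbs + Nat.size q.den

end RAM

/-! ## The capacitated assortment problem under the two-stage Luce model -/

/-- An instance of the capacitated assortment problem under the two-stage Luce model with products
`0, …, n - 1`: attractivenesses `a`, attractiveness `a₀` of the outside option, revenues `r`,
dominance relation `dom` (`dom x y` means that `x` dominates `y`) and capacity `C`. -/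
structure C2SLM (K : Type) [Field K] [LinearOrder K] where
  n : ℕ
  a : Fin n → K
  a₀ : K
  r : Fin n → K
  dom : Fin n → Fin n → Prop
  C : ℕ
  a_pos : ∀ i, 0 < a i
  a₀_nonneg : 0 ≤ a₀
  r_nonneg : ∀ i, 0 ≤ r i
  dom_irrefl : ∀ x, ¬ dom x x
  dom_trans : ∀ x y z, dom x y → dom y z → dom x z
  one_le_C : 1 ≤ C
  C_le_n : C ≤ n

namespace C2SLM

section
variable {K : Type} [Field K] [LinearOrder K] (M : C2SLM K)

open Classical in
/-- The consideration set `c(S)`: the undominated products of `S`. -/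
noncomputable def considered (S : Finset (Fin M.n)) : Finset (Fin M.n) :=
  S.filter fun x => ¬ ∃ y ∈ S, M.dom y x

/-- The probability `ρ(x, S)` that `x` is chosen from the offer set `S`. -/
noncomputable def choiceProb (x : Fin M.n) (S : Finset (Fin M.n)) : K :=
  if x ∈ M.considered S then M.a x / (∑ y ∈ M.considered S, M.a y + M.a₀) else 0

/-- The expected revenue `R(S)` under the two-stage Luce model. -/
noncomputable def expectedRevenue (S : Finset (Fin M.n)) : K :=
  ∑ i ∈ M.considered S, M.choiceProb i S * M.r i

/-- No product of `S` dominates a product of `S`. -/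
def DominanceFree (S : Finset (Fin M.n)) : Prop :=
  ∀ x ∈ S, ∀ y ∈ S, ¬ M.dom x y

/-- Feasibility: a dominance-free assortment of at most `C` products. -/
def Feasible (S : Finset (Fin M.n)) : Prop :=
  M.DominanceFree S ∧ S.card ≤ M.C

/-- Optimal solutions of the capacitated assortment problem under the two-stage Luce model. -/
def IsOptimal (S : Finset (Fin M.n)) : Prop :=
  M.Feasible S ∧ ∀ T, M.Feasible T → M.expectedRevenue T ≤ M.expectedRevenue S

/-- The expected revenue of `S` under the multinomial logit model with the same parameters. -/
noncomputable def mnlRevenue (S : Finset (Fin M.n)) : K :=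
  (∑ i ∈ S, M.r i * M.a i) / (∑ i ∈ S, M.a i + M.a₀)

/-- Optimal solutions of the capacitated assortment problem under the multinomial logit model with
product set `Y`. -/
def IsMNLOptimal (Y S : Finset (Fin M.n)) : Prop :=
  (S ⊆ Y ∧ S.card ≤ M.C) ∧
    ∀ T, T ⊆ Y → T.card ≤ M.C → M.mnlRevenue T ≤ M.mnlRevenue S

/-- On dominance-free assortments the expected revenue is the usual fraction. -/
theorem expectedRevenue_eq_mnlRevenue {S : Finset (Fin M.n)} (hS : M.DominanceFree S) :
    M.expectedRevenue S = M.mnlRevenue S := by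
  classical
  have hc : M.considered S = S := by
    unfold considered
    refine Finset.filter_true_of_mem fun x hx => ?_
    rintro ⟨y, hy, h⟩
    exact hS y hy x hx h
  simp only [expectedRevenue, mnlRevenue, choiceProb, hc, Finset.sum_div]
  refine Finset.sum_congr rfl fun i hi => ?_
  rw [if_pos hi]
  ring

/-- Attractiveness-correlated dominance: a dominating product is more attractive, and every product
more attractive than a product `x` dominates whatever `x` dominates. -/
def AttractivenessCorrelated : Prop :=
  (∀ x y, M.dom x y → M.a y < M.a x) ∧
    ∀ x y z, M.dom x y → M.a x < M.a z → M.dom z y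

/-- Equally attractive products dominate the same products. -/
def TieConsistent : Prop :=
  ∀ x y z, M.dom x y → M.a z = M.a x → M.dom z y

open Classical in
/-- The set `X_k` of the products no more attractive than `k` and not dominated by `k`. -/
noncomputable def X (k : Fin M.n) : Finset (Fin M.n) :=
  Finset.univ.filter fun i => M.a i ≤ M.a k ∧ ¬ M.dom k i

open Classical in
/-- The store that holds the instance: variables `0`, `1` hold `n`, `C`; array `0` holds the
`0`-`1` matrix of the dominance relation, row by row; numerical variable `0` holds `a₀`; numerical
arrays `0`, `1` hold `a`, `r`. Everything else is zero. -/
noncomputable def input : RAM.Store K where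
  nat x := if x = 0 then M.n else if x = 1 then M.C else 0
  natArr A p :=
    if A = 0 ∧ ∃ i j : Fin M.n, p = i.val * M.n + j.val ∧ M.dom i j then 1 else 0
  num x := if x = 0 then M.a₀ else 0
  numArr A p :=
    if h : p < M.n then (if A = 0 then M.a ⟨p, h⟩ else if A = 1 then M.r ⟨p, h⟩ else 0) else 0

/-- The assortment returned in a final store: product `i` is offered when cell `i` of the
natural-number array `1` is nonzero. -/
def output (s : RAM.Store K) : Finset (Fin M.n) :=
  Finset.univ.filter fun i => s.natArr 1 i.val ≠ 0

end

/-- The number of bits of a rational instance. -/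
def bitLength (M : C2SLM ℚ) : ℕ :=
  Nat.size M.n + Nat.size M.C + M.n * M.n + RAM.bitSize M.a₀ +
    ∑ i, (RAM.bitSize (M.a i) + RAM.bitSize (M.r i))

end C2SLM

/-! ## Cost bounds for programs that keep all data small -/

namespace RAM

open Polynomial

/-! Reduction. A dominance-free set lies in `X k` for any most attractive product `k` in it.
Conversely, if some `x` in `X k` dominated some `y` in `X k`, then `k`, being at least as attractive
as `x`, would dominate `y` as well. So the problem splits into `n` capacitated multinomial logit
problems (`dominanceFree_X`, `DominanceFree.exists_subset_X`, `isOptimal_of_mnlRevenue`).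

Each of these is a parametric problem. If `u > 0` is the optimal value, a nonempty set has revenue
at least `u` exactly when its margins `a i * (r i - u)` sum to at least `u * a₀`, and the largest
sum comes from the at most `C` largest positive margins. As functions of the parameter the margins
are lines: their signs change only at the revenues `r i`, their order only where two lines cross.
Hence `u` can be replaced by the largest breakpoint below it (or `0`), with ties broken towards the
smaller attractiveness, whose line falls more slowly (`margin_le_of_no_crossing`,
`sum_le_sum_smallest`, `exists_revenue_le_revenue_select`). As `u` is unknown, the program tries
every breakpoint for every `k` and keeps the best assortment.

Running time. Both cost models are treated at once by a calculus (`Runs`) in which all stored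
naturals, and the lengths of all stored field elements, stay below a number `V`; a polynomial in `V`
read off from the syntax then bounds the cost. Such a `V` exists because the program stores only the
data, breakpoints, sums over at most `n` products, and quotients of such sums: no long chain of
multiplications occurs. -/

theorem natSize_le_self (v : ℕ) : Nat.size v ≤ v :=
  Nat.size_le.2 Nat.lt_two_pow_self

/-- A length function `len` that dominates the size `sz` and is subadditive for all operations. -/
structure SizeBound {K : Type} [Field K] (sz len : K → ℕ) : Prop where
  sz_le : ∀ x, sz x ≤ 2 * len x
  zero : len 0 ≤ 2
  one : len 1 ≤ 2
  add : ∀ x y, len (x + y) ≤ len x + len y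
  sub : ∀ x y, len (x - y) ≤ len x + len y
  mul : ∀ x y, len (x * y) ≤ len x + len y
  div : ∀ x y, len (x / y) ≤ len x + len y

/-- All naturals in the store, and the lengths of all its field elements, are at most `V`. -/
structure Store.Bounded {K : Type} (len : K → ℕ) (V : ℕ) (s : Store K) : Prop where
  nat : ∀ x, s.nat x ≤ V
  natArr : ∀ A p, s.natArr A p ≤ V
  num : ∀ x, len (s.num x) ≤ V
  numArr : ∀ A p, len (s.numArr A p) ≤ V

/-- Bound for the value of an expression in terms of a bound for the store. -/
noncomputable def NatExpr.valPoly : NatExpr → ℕ[X]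
  | .const c => (c : ℕ[X])
  | .var _ => X
  | .get _ _ => X
  | .add e f => e.valPoly + f.valPoly
  | .sub e _ => e.valPoly
  | .mul e f => e.valPoly * f.valPoly

/-- Bound for the cost of an expression in terms of a bound for the store. -/
noncomputable def NatExpr.costPoly : NatExpr → ℕ[X]
  | .const c => 1 + (c : ℕ[X])
  | .var _ => 1 + X
  | .get _ i => i.costPoly + (1 + X)
  | .add e f => e.costPoly + f.costPoly + (1 + (e.valPoly + f.valPoly))
  | .sub e f => e.costPoly + f.costPoly + (1 + e.valPoly)
  | .mul e f => e.costPoly + f.costPoly + (1 + e.valPoly * f.valPoly)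

/-- Bound for the length of the value of an expression. -/
noncomputable def NumExpr.lenPoly : NumExpr → ℕ[X]
  | .zero => 2
  | .one => 2
  | .var _ => X
  | .get _ _ => X
  | .add e f => e.lenPoly + f.lenPoly
  | .sub e f => e.lenPoly + f.lenPoly
  | .mul e f => e.lenPoly + f.lenPoly
  | .div e f => e.lenPoly + f.lenPoly

/-- Bound for the cost of an expression. -/
noncomputable def NumExpr.costPoly : NumExpr → ℕ[X]
  | .zero => 1 + 2 * 2
  | .one => 1 + 2 * 2
  | .var _ => 1 + 2 * X
  | .get _ i => i.costPoly + (1 + 2 * X)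
  | .add e f => e.costPoly + f.costPoly + (1 + 2 * (e.lenPoly + f.lenPoly))
  | .sub e f => e.costPoly + f.costPoly + (1 + 2 * (e.lenPoly + f.lenPoly))
  | .mul e f => e.costPoly + f.costPoly + (1 + 2 * (e.lenPoly + f.lenPoly))
  | .div e f => e.costPoly + f.costPoly + (1 + 2 * (e.lenPoly + f.lenPoly))

/-- Bound for the cost of a test. -/
noncomputable def Test.costPoly : Test → ℕ[X]
  | .natLt e f => e.costPoly + f.costPoly + 1
  | .numLt e f => e.costPoly + f.costPoly + 1
  | .not b => b.costPoly + 1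
  | .and b c => b.costPoly + c.costPoly + 1

/-- Bound for the cost of a program in which no loop is repeated more often than the bound for the
store says. -/
noncomputable def Prog.costPoly : Prog → ℕ[X]
  | .skip => 1
  | .setNat _ e => e.costPoly + 1
  | .setNum _ e => e.costPoly + 1
  | .putNat _ i e => i.costPoly + e.costPoly + 1
  | .putNum _ i e => i.costPoly + e.costPoly + 1
  | .seq P Q => P.costPoly + Q.costPoly
  | .ite b P Q => b.costPoly + (P.costPoly + Q.costPoly)
  | .loop b P => (X + 1) * (b.costPoly + P.costPoly)

/-! ### Values and costs under the syntactic polynomial bounds -/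

section
variable {K : Type} {len : K → ℕ} {V : ℕ} {s : Store K}

/-- Only stored values are confined to `V`. An intermediate value, such as the matrix address in
`memberTest`, may exceed it, but stays polynomial in `V` because the expression is fixed. -/
theorem NatExpr.val_le (hs : s.Bounded len V) (e : NatExpr) : e.val s ≤ e.valPoly.eval V := by
  induction e with
  | const c => simp [val, valPoly]
  | var x => simpa [val, valPoly] using hs.nat x
  | get A i _ => simpa [val, valPoly] using hs.natArr A (i.val s)
  | add e f he hf => simpa [val, valPoly] using add_le_add he hf
  | sub e f he hf => exact (Nat.sub_le _ _).trans he
  | mul e f he hf => simpa [val, valPoly] using Nat.mul_le_mul he hf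

theorem NatExpr.cost_le (hs : s.Bounded len V) (e : NatExpr) : e.cost s ≤ e.costPoly.eval V := by
  induction e with
  | const c => simpa [cost, costPoly] using natSize_le_self c
  | var x => simpa [cost, costPoly] using (natSize_le_self _).trans (hs.nat x)
  | get A i hi =>
    have := (natSize_le_self _).trans (hs.natArr A (i.val s))
    simp only [cost, costPoly, eval_add, eval_one, eval_X]
    omega
  | add e f he hf =>
    have := (natSize_le_self _).trans (NatExpr.val_le hs (.add e f))
    simp only [cost, costPoly, val, valPoly, eval_add, eval_one] at this ⊢
    omega
  | sub e f he hf =>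
    have := (natSize_le_self _).trans (NatExpr.val_le hs (.sub e f))
    simp only [cost, costPoly, val, valPoly, eval_add, eval_one] at this ⊢
    omega
  | mul e f he hf =>
    have := (natSize_le_self _).trans (NatExpr.val_le hs (.mul e f))
    simp only [cost, costPoly, val, valPoly, eval_add, eval_one] at this ⊢
    omega

variable [Field K] {sz : K → ℕ}

theorem NumExpr.len_le (hl : SizeBound sz len) (hs : s.Bounded len V) (e : NumExpr) :
    len (e.val s) ≤ e.lenPoly.eval V := by
  induction e with
  | zero => simpa [val, lenPoly] using hl.zero
  | one => simpa [val, lenPoly] using hl.one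
  | var x => simpa [val, lenPoly] using hs.num x
  | get A i => simpa [val, lenPoly] using hs.numArr A (i.val s)
  | add e f he hf => simpa [val, lenPoly] using (hl.add _ _).trans (add_le_add he hf)
  | sub e f he hf => simpa [val, lenPoly] using (hl.sub _ _).trans (add_le_add he hf)
  | mul e f he hf => simpa [val, lenPoly] using (hl.mul _ _).trans (add_le_add he hf)
  | div e f he hf => simpa [val, lenPoly] using (hl.div _ _).trans (add_le_add he hf)

theorem NumExpr.cost_le (hl : SizeBound sz len) (hs : s.Bounded len V) (e : NumExpr) :
    e.cost sz s ≤ e.costPoly.eval V := by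
  have size_le (e : NumExpr) : sz (e.val s) ≤ 2 * e.lenPoly.eval V :=
    (hl.sz_le _).trans (Nat.mul_le_mul_left 2 (e.len_le hl hs))
  have eval_two : (2 : ℕ[X]).eval V = 2 := by simp
  induction e with
  | zero =>
    have := size_le .zero
    simp only [cost, costPoly, val, lenPoly, eval_add, eval_mul, eval_one, eval_two] at this ⊢
    omega
  | one =>
    have := size_le .one
    simp only [cost, costPoly, val, lenPoly, eval_add, eval_mul, eval_one, eval_two] at this ⊢
    omega
  | var x =>
    have := size_le (.var x)
    simp only [cost, costPoly, val, lenPoly, eval_add, eval_mul, eval_one, eval_two, eval_X] at this ⊢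
    omega
  | get A i =>
    have := size_le (.get A i)
    have := i.cost_le hs
    simp only [cost, costPoly, val, lenPoly, eval_add, eval_mul, eval_one, eval_two, eval_X] at *
    omega
  | add e f he hf =>
    have := size_le (.add e f)
    simp only [cost, costPoly, val, lenPoly, eval_add, eval_mul, eval_one, eval_two] at this ⊢
    omega
  | sub e f he hf =>
    have := size_le (.sub e f)
    simp only [cost, costPoly, val, lenPoly, eval_add, eval_mul, eval_one, eval_two] at this ⊢
    omega
  | mul e f he hf =>
    have := size_le (.mul e f)
    simp only [cost, costPoly, val, lenPoly, eval_add, eval_mul, eval_one, eval_two] at this ⊢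
    omega
  | div e f he hf =>
    have := size_le (.div e f)
    simp only [cost, costPoly, val, lenPoly, eval_add, eval_mul, eval_one, eval_two] at this ⊢
    omega

theorem Test.cost_le (hl : SizeBound sz len) (hs : s.Bounded len V) (b : Test) :
    b.cost sz s ≤ b.costPoly.eval V := by
  induction b with
  | natLt e f => simpa [cost, costPoly] using add_le_add (e.cost_le hs) (f.cost_le hs)
  | numLt e f => simpa [cost, costPoly] using add_le_add (e.cost_le hl hs) (f.cost_le hl hs)
  | not b hb => simpa [cost, costPoly] using hb
  | and b c hb hc => simpa [cost, costPoly] using add_le_add hb hc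

/-! ### Weakest preconditions with cost -/

variable [LinearOrder K]

/-- From the store `s`, if it is bounded by `V`, the program `P` halts within the cost
`P.costPoly.eval V`, in a store that is bounded by `V` and satisfies `Q`. -/
def Runs (sz len : K → ℕ) (V : ℕ) (P : Prog) (s : Store K) (Q : Store K → Prop) : Prop :=
  s.Bounded len V → ∃ s' t, Exec sz P s s' t ∧ t ≤ P.costPoly.eval V ∧ s'.Bounded len V ∧ Q s'

theorem Runs.mono {P : Prog} {Q Q' : Store K → Prop} (h : Runs sz len V P s Q)
    (hQ : ∀ s', Q s' → Q' s') : Runs sz len V P s Q' := fun hs => by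
  obtain ⟨s', t, h1, h2, h3, h4⟩ := h hs
  exact ⟨s', t, h1, h2, h3, hQ _ h4⟩

theorem runs_skip {Q : Store K → Prop} (h : Q s) : Runs sz len V .skip s Q :=
  fun hs => ⟨s, 1, .skip s, by simp [Prog.costPoly], hs, h⟩

theorem runs_setNat {Q : Store K → Prop} {x : ℕ} {e : NatExpr} (he : e.val s ≤ V)
    (h : Q { s with nat := Function.update s.nat x (e.val s) }) :
    Runs sz len V (.setNat x e) s Q := fun hs => by
  refine ⟨_, _, .setNat x e s, by simpa [Prog.costPoly] using e.cost_le hs,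
    ⟨fun y => ?_, hs.natArr, hs.num, hs.numArr⟩, h⟩
  rcases eq_or_ne y x with rfl | hy
  · simpa using he
  · simpa [hy] using hs.nat y

theorem runs_setNum (hl : SizeBound sz len) {Q : Store K → Prop} {x : ℕ} {e : NumExpr}
    (he : len (e.val s) ≤ V)
    (h : Q { s with num := Function.update s.num x (e.val s) }) :
    Runs sz len V (.setNum x e) s Q := fun hs => by
  refine ⟨_, _, .setNum x e s, by simpa [Prog.costPoly] using e.cost_le hl hs,
    ⟨hs.nat, hs.natArr, fun y => ?_, hs.numArr⟩, h⟩
  rcases eq_or_ne y x with rfl | hy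
  · simpa using he
  · simpa [hy] using hs.num y

theorem runs_putNat {Q : Store K → Prop} {A : ℕ} {i e : NatExpr} (he : e.val s ≤ V)
    (h : Q { s with natArr :=
      Function.update s.natArr A (Function.update (s.natArr A) (i.val s) (e.val s)) }) :
    Runs sz len V (.putNat A i e) s Q := fun hs => by
  refine ⟨_, _, .putNat A i e s,
    by simpa [Prog.costPoly] using add_le_add (i.cost_le hs) (e.cost_le hs),
    ⟨hs.nat, fun B p => ?_, hs.num, hs.numArr⟩, h⟩
  rcases eq_or_ne B A with rfl | hB
  · rcases eq_or_ne p (i.val s) with rfl | hp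
    · simpa using he
    · simpa [hp] using hs.natArr B p
  · simpa [hB] using hs.natArr B p

theorem runs_seq {P P' : Prog} {Q : Store K → Prop}
    (h : Runs sz len V P s fun s' => Runs sz len V P' s' Q) :
    Runs sz len V (.seq P P') s Q := fun hs => by
  obtain ⟨s', t, h1, h2, h3, h4⟩ := h hs
  obtain ⟨s'', t', h1', h2', h3', h4'⟩ := h4 h3
  exact ⟨s'', t + t', .seq h1 h1', by simpa [Prog.costPoly] using add_le_add h2 h2', h3', h4'⟩

theorem runs_ite (hl : SizeBound sz len) {b : Test} {P P' : Prog} {Q : Store K → Prop}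
    (h : b.Holds s → Runs sz len V P s Q) (h' : ¬ b.Holds s → Runs sz len V P' s Q) :
    Runs sz len V (.ite b P P') s Q := fun hs => by
  have hb := b.cost_le hl hs
  by_cases H : b.Holds s
  · obtain ⟨s', t, h1, h2, h3, h4⟩ := h H hs
    refine ⟨s', _, .iteTrue H h1, ?_, h3, h4⟩
    simp only [Prog.costPoly, eval_add]
    omega
  · obtain ⟨s', t, h1, h2, h3, h4⟩ := h' H hs
    refine ⟨s', _, .iteFalse H h1, ?_, h3, h4⟩
    simp only [Prog.costPoly, eval_add]
    omega

/-- `for x = 0, …, e - 1 do P`. -/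
def forLoop (x : ℕ) (e : NatExpr) (P : Prog) : Prog :=
  .seq (.setNat x (.const 0))
    (.loop (.natLt (.var x) e) (.seq P (.setNat x (.add (.var x) (.const 1)))))

/-- The invariant is indexed by the counter, which the body must restore. The hypothesis `N ≤ V`
allows the counter to be stored and justifies the factor `X + 1` in the cost polynomial of a loop.
-/
theorem runs_forLoop (hl : SizeBound sz len) {x : ℕ} {e : NatExpr} {P : Prog} {N : ℕ}
    {Q : Store K → Prop} (I : ℕ → Store K → Prop) (hN : N ≤ V)
    (he : ∀ m s', I m s' → s'.nat x = m ∧ e.val s' = N)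
    (h0 : I 0 { s with nat := Function.update s.nat x 0 })
    (hstep : ∀ m s', m < N → I m s' → Runs sz len V P s' fun s'' =>
      s''.nat x = m ∧ I (m + 1) { s'' with nat := Function.update s''.nat x (m + 1) })
    (hQ : ∀ s', I N s' → Q s') :
    Runs sz len V (forLoop x e P) s Q := by
  refine runs_seq (runs_setNat (Nat.zero_le _) fun hs => ?_)
  set T : Test := .natLt (.var x) e with hT
  set body : Prog := .seq P (.setNat x (.add (.var x) (.const 1))) with hbody
  -- Induction on the number `d` of rounds left; the extra one in `d + 1` pays for the last, failing
  -- test.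
  have key : ∀ d m s', m + d = N → I m s' → s'.Bounded len V →
      ∃ s'' t, Exec sz (.loop T body) s' s'' t ∧
        t ≤ (d + 1) * (T.costPoly + body.costPoly).eval V ∧ s''.Bounded len V ∧ I N s'' := by
    intro d
    induction d with
    | zero =>
      intro m s' hm hI hs'
      obtain ⟨h1, h2⟩ := he m s' hI
      have hm' : m = N := by omega
      refine ⟨s', _, .loopDone ?_, ?_, hs', hm' ▸ hI⟩
      · simp [hT, Test.Holds, NatExpr.val, h1, h2, hm']
      · have := T.cost_le hl hs'
        simp only [eval_add]
        omega
    | succ d ih =>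
      intro m s' hm hI hs'
      obtain ⟨h1, h2⟩ := he m s' hI
      have hbr : Runs sz len V body s' (I (m + 1)) := by
        refine runs_seq ((hstep m s' (by omega) hI).mono fun s'' hs'' => ?_)
        have hv : (NatExpr.add (.var x) (.const 1)).val s'' = m + 1 := by
          simp [NatExpr.val, hs''.1]
        refine runs_setNat (by omega) ?_
        rw [hv]
        exact hs''.2
      obtain ⟨s1, t1, e1, c1, b1, i1⟩ := hbr hs'
      obtain ⟨s2, t2, e2, c2, b2, i2⟩ := ih (m + 1) s1 (by omega) i1 b1
      refine ⟨s2, _, .loopStep ?_ e1 e2, ?_, b2, i2⟩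
      · simp only [hT, Test.Holds, NatExpr.val, h1, h2]
        omega
      · have := T.cost_le hl hs'
        have : (d + 1 + 1) * (T.costPoly + body.costPoly).eval V =
          (d + 1) * (T.costPoly + body.costPoly).eval V + (T.costPoly.eval V + body.costPoly.eval V) := by
          rw [eval_add]; ring
        omega
  obtain ⟨s', t, h1, h2, h3, h4⟩ := key N 0 _ (by omega) h0 hs
  refine ⟨s', t, h1, h2.trans ?_, h3, hQ _ h4⟩
  simp only [Prog.costPoly, eval_add, eval_mul, eval_X, eval_one]
  exact Nat.mul_le_mul_right _ (by omega)

end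

end RAM

/-! ### The two cost models -/

namespace RAM

theorem sizeBound_unitSize {K : Type} [Field K] :
    SizeBound (unitSize : K → ℕ) fun _ => 1 := by
  constructor <;> simp [unitSize]

/-- One plus the larger number of bits of numerator and denominator. -/
def ratLen (q : ℚ) : ℕ := max (Nat.size q.num.natAbs) (Nat.size q.den) + 1

theorem ratLen_le_iff {q : ℚ} {m : ℕ} :
    ratLen q ≤ m + 1 ↔ q.num.natAbs < 2 ^ m ∧ q.den < 2 ^ m := by
  simp [ratLen, Nat.size_le]

theorem lt_two_pow_ratLen (q : ℚ) :
    q.num.natAbs < 2 ^ (ratLen q - 1) ∧ q.den < 2 ^ (ratLen q - 1) :=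
  ratLen_le_iff.1 (by simp [ratLen])

theorem two_le_ratLen (q : ℚ) : 2 ≤ ratLen q := by
  have : 0 < Nat.size q.den := Nat.size_pos.2 q.pos
  simp only [ratLen]
  omega

/-- Lowest terms divide any other representation (the numerator zero aside), so unreduced fractions
suffice for upper bounds. -/
theorem ratLen_le_of_divInt {q : ℚ} {z d : ℤ} {m : ℕ} (hq : q = Rat.divInt z d) (hd : d ≠ 0)
    (hz : z.natAbs < 2 ^ m) (hd' : d.natAbs < 2 ^ m) : ratLen q ≤ m + 1 := by
  have hden : q.den ∣ d.natAbs := by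
    have := Rat.den_dvd z d
    rw [← hq] at this
    exact Int.natCast_dvd.1 this
  refine ratLen_le_iff.2 ⟨?_, (Nat.le_of_dvd (Int.natAbs_pos.2 hd) hden).trans_lt hd'⟩
  rcases eq_or_ne z 0 with rfl | hz0
  · simp [hq]
  · have hnum : q.num ∣ z := by
      rw [hq]
      exact Rat.num_dvd z hd
    exact (Nat.le_of_dvd (Int.natAbs_pos.2 hz0) (Int.natAbs_dvd_natAbs.2 hnum)).trans_lt hz

/-- Over the common denominator the numerator is a sum of two products and may need one bit more
than its factors together. The `+ 1` in `ratLen`, counted twice on the right and once on the left,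
pays for this carry. -/
theorem ratLen_add_le (x y : ℚ) : ratLen (x + y) ≤ ratLen x + ratLen y := by
  obtain ⟨hx, hx'⟩ := lt_two_pow_ratLen x
  obtain ⟨hy, hy'⟩ := lt_two_pow_ratLen y
  have h2x := two_le_ratLen x
  have h2y := two_le_ratLen y
  obtain ⟨u, hu⟩ : ∃ u, ratLen x = u + 1 := ⟨ratLen x - 1, by omega⟩
  obtain ⟨v, hv⟩ : ∃ v, ratLen y = v + 1 := ⟨ratLen y - 1, by omega⟩
  rw [hu] at hx hx' ⊢
  rw [hv] at hy hy' ⊢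
  simp only [Nat.add_sub_cancel] at hx hx' hy hy'
  have hxd : (x.den : ℤ) ≠ 0 := by exact_mod_cast x.den_nz
  have hyd : (y.den : ℤ) ≠ 0 := by exact_mod_cast y.den_nz
  have hp : 2 ^ (u + v + 1) = 2 ^ u * 2 ^ v + 2 ^ u * 2 ^ v := by ring
  have h1 : x.num.natAbs * y.den < 2 ^ u * 2 ^ v := Nat.mul_lt_mul'' hx hy'
  have h2 : y.num.natAbs * x.den < 2 ^ u * 2 ^ v := by
    rw [mul_comm]; exact Nat.mul_lt_mul'' hx' hy
  have h3 : x.den * y.den < 2 ^ u * 2 ^ v := Nat.mul_lt_mul'' hx' hy'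
  have : u + 1 + (v + 1) = u + v + 1 + 1 := by ring
  rw [this]
  refine ratLen_le_of_divInt (z := x.num * y.den + y.num * x.den) (d := x.den * y.den) ?_
    (mul_ne_zero hxd hyd) ?_ ?_
  · rw [← Rat.divInt_add_divInt _ _ hxd hyd, Rat.num_divInt_den, Rat.num_divInt_den]
  · refine (Int.natAbs_add_le _ _).trans_lt ?_
    simp only [Int.natAbs_mul, Int.natAbs_natCast]
    omega
  · simp only [Int.natAbs_mul, Int.natAbs_natCast]
    omega

theorem ratLen_neg (x : ℚ) : ratLen (-x) = ratLen x := by simp [ratLen]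

/-- Inversion swaps numerator and denominator up to sign, which the maximum does not notice;
division thus reduces to multiplication. -/
theorem ratLen_inv (x : ℚ) : ratLen x⁻¹ = ratLen x := by
  rcases eq_or_ne x 0 with rfl | hx
  · simp
  · have hx' : x.num.natAbs ≠ 0 := by simpa using hx
    simp only [ratLen, Rat.num_inv, Rat.den_inv_of_ne_zero hx, Int.natAbs_mul, Int.natAbs_natCast]
    rw [Int.natAbs_sign_of_ne_zero (by simpa using hx), one_mul, max_comm]

theorem ratLen_mul_le (x y : ℚ) : ratLen (x * y) ≤ ratLen x + ratLen y := by
  obtain ⟨hx, hx'⟩ := lt_two_pow_ratLen x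
  obtain ⟨hy, hy'⟩ := lt_two_pow_ratLen y
  have h2x := two_le_ratLen x
  have h2y := two_le_ratLen y
  have hxd : (x.den : ℤ) ≠ 0 := by exact_mod_cast x.den_nz
  have hyd : (y.den : ℤ) ≠ 0 := by exact_mod_cast y.den_nz
  refine (ratLen_le_of_divInt (m := (ratLen x - 1) + (ratLen y - 1)) (z := x.num * y.num)
    (d := x.den * y.den) ?_ (mul_ne_zero hxd hyd) ?_ ?_).trans (by omega)
  · rw [← Rat.divInt_mul_divInt, Rat.num_divInt_den, Rat.num_divInt_den]
  · rw [pow_add, Int.natAbs_mul]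
    exact Nat.mul_lt_mul'' hx hy
  · rw [pow_add, Int.natAbs_mul]
    exact Nat.mul_lt_mul'' hx' hy'

theorem sizeBound_bitSize : SizeBound bitSize ratLen where
  sz_le q := by simp only [bitSize, ratLen]; omega
  zero := by decide
  one := by decide
  add := ratLen_add_le
  sub x y := by simpa [sub_eq_add_neg, ratLen_neg] using ratLen_add_le x (-y)
  mul := ratLen_mul_le
  div x y := by simpa [div_eq_mul_inv, ratLen_inv] using ratLen_mul_le x y⁻¹

theorem ratLen_le_bitSize (q : ℚ) : ratLen q ≤ bitSize q + 1 := by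
  simp only [bitSize, ratLen]; omega

end RAM

/-! ## Greedy selection and the capacitated multinomial logit problem -/

namespace CapacitatedMNL

open Finset

/-! ### Greedy choice of the best-ranked elements -/

section Greedy
variable {ι κ : Type*} [LinearOrder κ]

/-- The number of elements of `Z` whose key is smaller than that of `x`. -/
def rank (key : ι → κ) (Z : Finset ι) (x : ι) : ℕ := #{y ∈ Z | key y < key x}

/-- The `C` elements of `Z` with the smallest keys. -/
def smallest (key : ι → κ) (Z : Finset ι) (C : ℕ) : Finset ι := {x ∈ Z | rank key Z x < C}

variable {key : ι → κ} {Z : Finset ι} {C : ℕ}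

theorem rank_lt_rank {x y : ι} (hx : x ∈ Z) (h : key x < key y) :
    rank key Z x < rank key Z y := by
  refine card_lt_card (ssubset_iff_of_subset ?_ |>.2 ⟨x, ?_, ?_⟩)
  · intro z hz
    simp only [mem_filter] at hz ⊢
    exact ⟨hz.1, hz.2.trans h⟩
  · simp [hx, h]
  · simp

theorem key_lt_of_rank_lt {x y : ι} (hy : y ∈ Z) (hkey : Function.Injective key)
    (h : rank key Z x < rank key Z y) : key x < key y := by
  rcases lt_trichotomy (key x) (key y) with h1 | h1 | h1
  · exact h1
  · rw [hkey h1] at h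
    exact absurd h (lt_irrefl _)
  · exact absurd (rank_lt_rank hy h1) h.not_gt

/-- Injective keys make the rank injective on the selection, where its values are below `C`. -/
theorem card_smallest_le (hkey : Function.Injective key) : #(smallest key Z C) ≤ C := by
  have hinj : Set.InjOn (rank key Z) (smallest key Z C) := by
    intro x hx y hy h
    simp only [smallest, coe_filter, Set.mem_ofPred_eq] at hx hy
    by_contra hxy
    rcases lt_or_gt_of_ne (hkey.ne hxy) with h1 | h1
    · exact (rank_lt_rank hx.1 h1).ne h
    · exact (rank_lt_rank hy.1 h1).ne' h
  calc #(smallest key Z C) = #((smallest key Z C).image (rank key Z)) :=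
        (card_image_of_injOn hinj).symm
    _ ≤ #(range C) := card_le_card fun m hm => by
        obtain ⟨x, hx, rfl⟩ := mem_image.1 hm
        simpa using (mem_filter.1 hx).2
    _ = C := card_range C

variable [DecidableEq ι] {K : Type*} [Field K] [LinearOrder K] [IsStrictOrderedRing K]

/-- If the weights `w` are nonnegative on `Z`, nonpositive outside, and weakly decreasing along the
keys, then the elements of `Z` with smallest keys have the largest total weight. -/
theorem sum_le_sum_smallest {w : ι → K} (hkey : Function.Injective key)
    (hnonneg : ∀ x ∈ Z, 0 ≤ w x)
    (hanti : ∀ x ∈ Z, ∀ y ∈ Z, key x < key y → w y ≤ w x) {T : Finset ι} (hC : #T ≤ C)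
    (hT : ∀ x ∈ T, x ∉ Z → w x ≤ 0) :
    ∑ x ∈ T, w x ≤ ∑ x ∈ smallest key Z C, w x := by
  set S := smallest key Z C with hS
  have hSZ : ∀ x ∈ S, x ∈ Z := fun x hx => (mem_filter.1 hx).1
  -- Exchange argument with a threshold: elements only in `T` weigh at most `θ`, elements only in
  -- `S` at least `θ`, and there are at least as many of the latter unless `θ = 0`, when numbers do
  -- not matter.
  suffices ∃ θ : K, 0 ≤ θ ∧ (∀ x ∈ T \ S, w x ≤ θ) ∧ (∀ x ∈ S, θ ≤ w x) ∧ (θ = 0 ∨ #T ≤ #S) by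
    obtain ⟨θ, h0, h1, h2, h3⟩ := this
    rw [← sum_sdiff_le_sum_sdiff]
    calc ∑ x ∈ T \ S, w x ≤ #(T \ S) • θ := sum_le_card_nsmul _ _ _ h1
      _ ≤ #(S \ T) • θ := by
        rcases h3 with rfl | h3
        · simp
        · exact nsmul_le_nsmul_left h0 (card_sdiff_le_card_sdiff_iff.2 h3)
      _ ≤ ∑ x ∈ S \ T, w x := card_nsmul_le_sum _ _ _ fun x hx => h2 x (mem_sdiff.1 hx).1
  by_cases hne : ({x ∈ Z | C ≤ rank key Z x} : Finset ι).Nonempty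
  · obtain ⟨q, hq, hmin⟩ := exists_min_image _ key hne
    simp only [mem_filter] at hq hmin
    refine ⟨w q, hnonneg q hq.1, fun x hx => ?_, fun x hx => ?_, Or.inr ?_⟩
    · rw [mem_sdiff] at hx
      by_cases hxZ : x ∈ Z
      · have hxC : C ≤ rank key Z x := by
          by_contra h
          exact hx.2 (mem_filter.2 ⟨hxZ, not_le.1 h⟩)
        rcases (hmin x ⟨hxZ, hxC⟩).lt_or_eq with h | h
        · exact hanti q hq.1 x hxZ h
        · rw [hkey h]
      · exact (hT x hx.1 hxZ).trans (hnonneg q hq.1)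
    · exact hanti x (hSZ x hx) q hq.1
        (key_lt_of_rank_lt hq.1 hkey ((mem_filter.1 hx).2.trans_le hq.2))
    -- By minimality of `q` all elements of `Z` ranked before `q` are selected, and there are at
    -- least `C` of them.
    · refine hC.trans (hq.2.trans (card_le_card fun x hx => ?_))
      rw [mem_filter] at hx
      refine mem_filter.2 ⟨hx.1, ?_⟩
      by_contra h
      exact (hmin x ⟨hx.1, not_lt.1 h⟩).not_gt hx.2
  -- Nothing in `Z` is left out, so the rest of `T` lies outside `Z` and has nonpositive weights.
  · refine ⟨0, le_rfl, fun x hx => ?_, fun x hx => hnonneg x (hSZ x hx), Or.inl rfl⟩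
    rw [mem_sdiff] at hx
    refine hT x hx.1 fun hxZ => hne ⟨x, mem_filter.2 ⟨hxZ, ?_⟩⟩
    by_contra h
    exact hx.2 (mem_filter.2 ⟨hxZ, not_le.1 h⟩)

end Greedy

/-! ### Breakpoints of the capacitated multinomial logit problem -/

section
variable {K : Type*} [Field K]

/-- Multinomial logit revenue. -/
def revenue (a r : ℕ → K) (a₀ : K) (S : Finset ℕ) : K :=
  (∑ i ∈ S, a i * r i) / (∑ i ∈ S, a i + a₀)

/-- The weighted margin of a product over `lam`. -/
def margin (a r : ℕ → K) (lam : K) (x : ℕ) : K := a x * (r x - lam)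

/-- Products are ranked by decreasing margin, then by increasing attractiveness. -/
def rankKey (a r : ℕ → K) (lam : K) (x : ℕ) : Kᵒᵈ ×ₗ K ×ₗ ℕ :=
  toLex (OrderDual.toDual (margin a r lam x), toLex (a x, x))

/-- The revenue at which the margins of two products agree. -/
def crossing (a r : ℕ → K) (i j : ℕ) : K := (a i * r i - a j * r j) / (a i - a j)

theorem margin_eq (a r : ℕ → K) (lam : K) (x : ℕ) :
    margin a r lam x = a x * r x - lam * a x := by
  unfold margin; ring

theorem rankKey_injective (a r : ℕ → K) (lam : K) : Function.Injective (rankKey a r lam) := by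
  intro x y h
  simp only [rankKey, EmbeddingLike.apply_eq_iff_eq, Prod.mk.injEq] at h
  exact h.2.2

variable [LinearOrder K]

theorem rankKey_lt_iff {a r : ℕ → K} {lam : K} {x y : ℕ} :
    rankKey a r lam y < rankKey a r lam x ↔
      margin a r lam x < margin a r lam y ∨
        margin a r lam x = margin a r lam y ∧ (a y < a x ∨ a y = a x ∧ y < x) := by
  simp only [rankKey, Prod.Lex.toLex_lt_toLex, OrderDual.toDual_lt_toDual, OrderDual.toDual_inj,
    eq_comm (a := margin a r lam x)]

/-- The products of `Y` with positive margin over `lam`. -/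
def profitable (a r : ℕ → K) (Y : Finset ℕ) (lam : K) : Finset ℕ := {x ∈ Y | 0 < margin a r lam x}

/-- The best products of `Y` for the margins over `lam`, at most `C` of them. -/
def select (a r : ℕ → K) (Y : Finset ℕ) (C : ℕ) (lam : K) : Finset ℕ :=
  smallest (rankKey a r lam) (profitable a r Y lam) C

theorem select_subset (a r : ℕ → K) (Y : Finset ℕ) (C : ℕ) (lam : K) :
    select a r Y C lam ⊆ Y :=
  (filter_subset _ _).trans (filter_subset _ _)

theorem card_select_le (a r : ℕ → K) (Y : Finset ℕ) (C : ℕ) (lam : K) :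
    #(select a r Y C lam) ≤ C :=
  card_smallest_le (rankKey_injective a r lam)

/-- This is the form that the program tests: the count runs over all of `Y`, not only over the
profitable products. The counts agree because whatever ranks before a product of positive margin has
at least that margin. -/
theorem mem_select_iff {a r : ℕ → K} {Y : Finset ℕ} {C : ℕ} {lam : K} {x : ℕ} :
    x ∈ select a r Y C lam ↔
      x ∈ Y ∧ 0 < margin a r lam x ∧ #{y ∈ Y | rankKey a r lam y < rankKey a r lam x} < C := by
  simp only [select, smallest, mem_filter, profitable, rank, filter_filter]
  refine and_congr_right fun _ => and_congr_right fun hx => ?_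
  rw [filter_congr fun y _ => and_iff_right_of_imp fun h => ?_]
  rcases rankKey_lt_iff.1 h with h | h
  · exact hx.trans h
  · exact hx.trans_le h.1.le

variable [IsStrictOrderedRing K]

theorem revenue_nonneg {a r : ℕ → K} {a₀ : K} {S : Finset ℕ} (ha : ∀ i ∈ S, 0 ≤ a i)
    (hr : ∀ i ∈ S, 0 ≤ r i) (h₀ : 0 ≤ a₀) : 0 ≤ revenue a r a₀ S :=
  div_nonneg (sum_nonneg fun i hi => mul_nonneg (ha i hi) (hr i hi))
    (add_nonneg (sum_nonneg ha) h₀)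

/-- Margins over `u` that lie strictly in order for `lam < u` stay in order unless the crossing
lies strictly in between. -/
theorem margin_le_of_no_crossing {a r : ℕ → K} {lam u : K} {x y : ℕ} (hlu : lam ≤ u)
    (hcross : ∀ i j, (i = x ∧ j = y ∨ i = y ∧ j = x) → a j < a i →
      ¬ (lam < crossing a r i j ∧ crossing a r i j < u))
    (h : rankKey a r lam y < rankKey a r lam x) : margin a r u x ≤ margin a r u y := by
  simp only [rankKey_lt_iff, margin_eq] at h
  simp only [margin_eq]
  -- If `y` is no more attractive than `x`, its line falls no faster and its lead at `lam` persists.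
  -- Otherwise tie-breaking makes that lead strict, and it can turn into a deficit at `u` only
  -- through a crossing strictly in between.
  rcases le_or_gt (a y) (a x) with hxy | hxy
  · have : a x * r x - lam * a x ≤ a y * r y - lam * a y := by
      rcases h with h | h
      · exact h.le
      · exact h.1.le
    nlinarith [mul_nonneg (sub_nonneg.2 hlu) (sub_nonneg.2 hxy)]
  · rcases h with h | h
    · by_contra hlt
      have hd : 0 < a y - a x := sub_pos.2 hxy
      refine hcross y x (Or.inr ⟨rfl, rfl⟩) hxy ⟨?_, ?_⟩
      · rw [crossing, lt_div_iff₀ hd]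
        linarith
      · rw [crossing, div_lt_iff₀ hd]
        linarith
    · rcases h.2 with h' | h'
      · exact absurd h' hxy.not_gt
      · exact absurd h'.1 hxy.ne'

/-- A capacitated multinomial logit problem is solved by `select` for one of the candidates, provided
that `0`, all revenues, and all crossings are candidates. -/
theorem exists_revenue_le_revenue_select {a r : ℕ → K} {a₀ : K} {Y : Finset ℕ} {C : ℕ}
    {cand : Finset K} (ha : ∀ i ∈ Y, 0 < a i) (hr : ∀ i ∈ Y, 0 ≤ r i) (h₀ : 0 ≤ a₀)
    (hzero : 0 ∈ cand) (hrev : ∀ i ∈ Y, r i ∈ cand)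
    (hcross : ∀ i ∈ Y, ∀ j ∈ Y, a j < a i → crossing a r i j ∈ cand) :
    ∃ lam ∈ cand, ∀ T ⊆ Y, #T ≤ C → revenue a r a₀ T ≤ revenue a r a₀ (select a r Y C lam) := by
  have hden : ∀ T ⊆ Y, T.Nonempty → 0 < ∑ i ∈ T, a i + a₀ := fun T hT hne =>
    add_pos_of_pos_of_nonneg (sum_pos (fun i hi => ha i (hT hi)) hne) h₀
  obtain ⟨T, hTmem, hTmax⟩ := exists_max_image (Y.powerset.filter fun T => #T ≤ C)
    (revenue a r a₀) ⟨∅, by simp⟩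
  simp only [mem_filter, mem_powerset] at hTmem hTmax
  set u := revenue a r a₀ T with hu
  suffices ∃ lam ∈ cand, u ≤ revenue a r a₀ (select a r Y C lam) by
    obtain ⟨lam, h1, h2⟩ := this
    exact ⟨lam, h1, fun T' h3 h4 => (hTmax T' ⟨h3, h4⟩).trans h2⟩
  -- If `u ≤ 0`, any nonnegative revenue is good enough. Otherwise `0` is a candidate below `u`, so
  -- a largest such candidate exists.
  rcases le_or_gt u 0 with hu0 | hu0
  · exact ⟨0, hzero, hu0.trans (revenue_nonneg
      (fun i hi => (ha i (select_subset _ _ _ _ _ hi)).le)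
      (fun i hi => hr i (select_subset _ _ _ _ _ hi)) h₀)⟩
  obtain ⟨lam, hlam, hmax⟩ := exists_max_image (cand.filter fun c => c < u) id
    ⟨0, mem_filter.2 ⟨hzero, hu0⟩⟩
  rw [mem_filter] at hlam
  have hno : ∀ c ∈ cand, ¬ (lam < c ∧ c < u) := fun c hc h =>
    (hmax c (mem_filter.2 ⟨hc, h.2⟩)).not_gt h.1
  refine ⟨lam, hlam.1, ?_⟩
  set S := select a r Y C lam with hS
  have hTne : T.Nonempty := by
    rw [nonempty_iff_ne_empty]
    rintro rfl
    simp [hu, revenue] at hu0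
  have hTsum : ∑ i ∈ T, margin a r u i = u * a₀ := by
    have : u * (∑ i ∈ T, a i + a₀) = ∑ i ∈ T, a i * r i :=
      div_mul_cancel₀ _ (hden T hTmem.1 hTne).ne'
    simp only [margin_eq, sum_sub_distrib, ← mul_sum]
    linarith
  -- The greedy inequality is used with ranks taken at `lam` and weights taken at `u`. Its
  -- hypotheses hold because no revenue and no crossing lies strictly between the two.
  have hle : ∑ i ∈ T, margin a r u i ≤ ∑ i ∈ S, margin a r u i := by
    refine sum_le_sum_smallest (rankKey_injective a r lam) (fun x hx => ?_)
      (fun x hx y hy h => margin_le_of_no_crossing hlam.2.le ?_ h) hTmem.2 fun x hx hxn => ?_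
    · obtain ⟨hxY, hx⟩ := mem_filter.1 hx
      have h1 : lam < r x :=
        sub_pos.1 ((mul_pos_iff_of_pos_left (ha x hxY)).1 hx)
      refine mul_nonneg (ha x hxY).le (sub_nonneg.2 ?_)
      by_contra h2
      exact hno _ (hrev x hxY) ⟨h1, not_le.1 h2⟩
    · have hx' := (mem_filter.1 hx).1
      have hy' := (mem_filter.1 hy).1
      rintro i j (⟨rfl, rfl⟩ | ⟨rfl, rfl⟩) hij
      · exact hno _ (hcross _ hy' _ hx' hij)
      · exact hno _ (hcross _ hx' _ hy' hij)
    · have hxY := hTmem.1 hx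
      have h1 : margin a r lam x ≤ 0 := by
        by_contra h
        exact hxn (mem_filter.2 ⟨hxY, not_le.1 h⟩)
      rw [margin_eq] at h1 ⊢
      nlinarith [mul_pos (sub_pos.2 hlam.2) (ha x hxY)]
  have hSsum : u * (∑ i ∈ S, a i + a₀) ≤ ∑ i ∈ S, a i * r i := by
    have : ∑ i ∈ S, margin a r u i = ∑ i ∈ S, a i * r i - u * ∑ i ∈ S, a i := by
      simp only [margin_eq, sum_sub_distrib, ← mul_sum]
    linarith
  -- Needed for `a₀ = 0`, when the empty set satisfies `hSsum` with denominator zero. On `T` the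
  -- margins over `lam` exceed those over `u`, so their sum is positive and the greedy choice at
  -- `lam` cannot be empty.
  have hSne : S.Nonempty := by
    by_contra hemp
    rw [not_nonempty_iff_eq_empty] at hemp
    have h1 : ∑ i ∈ T, margin a r lam i ≤ ∑ i ∈ S, margin a r lam i := by
      refine sum_le_sum_smallest (rankKey_injective a r lam)
        (fun x hx => (mem_filter.1 hx).2.le) (fun x _ y _ h => ?_) hTmem.2 fun x hx hxn => ?_
      · rcases rankKey_lt_iff.1 h with h | h
        · exact h.le
        · exact h.1.le
      · by_contra h
        exact hxn (mem_filter.2 ⟨hTmem.1 hx, not_le.1 h⟩)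
    have h2 : ∑ i ∈ T, margin a r u i < ∑ i ∈ T, margin a r lam i :=
      sum_lt_sum_of_nonempty hTne fun i hi =>
        mul_lt_mul_of_pos_left (sub_lt_sub_left hlam.2 _) (ha i (hTmem.1 hi))
    rw [hemp, sum_empty] at h1
    linarith [mul_nonneg hu0.le h₀]
  rw [revenue, le_div_iff₀ (hden S (select_subset _ _ _ _ _) hSne)]
  exact hSsum

end

end CapacitatedMNL

/-! ## The program -/

namespace RAM

/-- Disjunction of tests. -/
def Test.or (b c : Test) : Test := .not (.and (.not b) (.not c))

/-! Natural-number variables: `0` is `n`, `1` is `C`, `2` is `k`, `3` and `4` are the two products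
that define the candidate, `5` and `6` run over the products, `7` is a counter. Numerical variables:
`0` is `a₀`, `1` the best revenue so far, `2` the candidate, `3` and `4` the numerator and the
denominator (without `a₀`) of the revenue. Array `1` holds the best assortment so far, array `2` the
current one. -/

/-- The margin of a product over the candidate. -/
def marginExpr (p : NatExpr) : NumExpr := .mul (.get 0 p) (.sub (.get 1 p) (.var 2))

/-- Membership of a product in `X_k`. -/
def memberTest (p : NatExpr) : Test :=
  .and (.not (.numLt (.get 0 (.var 2)) (.get 0 p)))
    (.not (.natLt (.const 0) (.get 0 (.add (.mul (.var 2) (.var 0)) p))))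

/-- The product in variable `6` is ranked before the product in variable `5`. -/
def beforeTest : Test :=
  .or (.numLt (marginExpr (.var 5)) (marginExpr (.var 6)))
    (.and (.not (.numLt (marginExpr (.var 6)) (marginExpr (.var 5))))
      (.or (.numLt (.get 0 (.var 6)) (.get 0 (.var 5)))
        (.and (.not (.numLt (.get 0 (.var 5)) (.get 0 (.var 6)))) (.natLt (.var 6) (.var 5)))))

/-- Count the products of `X_k` before the product in variable `5`. -/
def countProg : Prog :=
  .seq (.setNat 7 (.const 0))
    (forLoop 6 (.var 0) (.ite (.and (memberTest (.var 6)) beforeTest)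
      (.setNat 7 (.add (.var 7) (.const 1))) .skip))

/-- The product in variable `5` is selected, once the counter is set. -/
def selectTest : Test :=
  .and (memberTest (.var 5))
    (.and (.numLt .zero (marginExpr (.var 5))) (.natLt (.var 7) (.var 1)))

/-- Add the product in variable `5` to the current assortment. -/
def addProg : Prog :=
  .seq (.putNat 2 (.var 5) (.const 1))
    (.seq (.setNum 3 (.add (.var 3) (.mul (.get 0 (.var 5)) (.get 1 (.var 5)))))
      (.setNum 4 (.add (.var 4) (.get 0 (.var 5)))))

/-- Compute the current assortment and its revenue. -/
def selectProg : Prog :=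
  .seq (.setNum 3 .zero) (.seq (.setNum 4 .zero)
    (forLoop 5 (.var 0) (.seq countProg
      (.ite selectTest addProg (.putNat 2 (.var 5) (.const 0))))))

/-- Replace the best assortment by the current one if that is better. -/
def updateProg : Prog :=
  .ite (.numLt (.mul (.var 1) (.add (.var 4) (.var 0))) (.var 3))
    (.seq (.setNum 1 (.div (.var 3) (.add (.var 4) (.var 0))))
      (forLoop 5 (.var 0) (.putNat 1 (.var 5) (.get 2 (.var 5)))))
    .skip

/-- Compute the candidate. -/
def candidateProg : Prog :=
  .ite (.numLt (.get 0 (.var 4)) (.get 0 (.var 3)))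
    (.setNum 2 (.div
      (.sub (.mul (.get 0 (.var 3)) (.get 1 (.var 3))) (.mul (.get 0 (.var 4)) (.get 1 (.var 4))))
      (.sub (.get 0 (.var 3)) (.get 0 (.var 4)))))
    (.setNum 2 .zero)

/-- The program that solves the capacitated assortment problem. -/
def assortmentProg : Prog :=
  forLoop 2 (.var 0) (forLoop 3 (.add (.var 0) (.const 1)) (forLoop 4 (.add (.var 0) (.const 1))
    (.seq candidateProg (.seq selectProg updateProg))))

end RAM

/-! ## Correctness and running time of the program -/

namespace CapacitatedMNL

open Finset RAM

variable {K : Type}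

/-- The data on which the program works. -/
structure ProgData (K : Type) where
  n : ℕ
  C : ℕ
  a : ℕ → K
  r : ℕ → K
  a₀ : K
  dom : ℕ → ℕ

namespace ProgData

variable (M : ProgData K)

/-- The store holds the data. -/
structure Loaded (s : Store K) : Prop where
  n : s.nat 0 = M.n
  C : s.nat 1 = M.C
  dom : s.natArr 0 = M.dom
  a₀ : s.num 0 = M.a₀
  a : s.numArr 0 = M.a
  r : s.numArr 1 = M.r

/-- All data have length at most `L`, and `V` is large enough for all intermediate results. -/
structure Short (len : K → ℕ) (L V : ℕ) : Prop where
  a : ∀ p, len (M.a p) ≤ L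
  r : ∀ p, len (M.r p) ≤ L
  a₀ : len M.a₀ ≤ L
  le : 10 * ((M.n + 1) * (L + 1)) ≤ V

variable {M} {s : Store K} {sz len : K → ℕ} {V : ℕ}

theorem Short.n_lt {L : ℕ} (h : M.Short len L V) : M.n + 1 ≤ V := by
  have := h.le
  nlinarith [Nat.zero_le (M.n * L), Nat.zero_le M.n, Nat.zero_le L]

/-- The constant is generous: a candidate has length at most `6 * L`, a revenue at most `4 + 3 *
(M.n * L) + L`. In expanded form `M.n * L` is an atom for `omega`. -/
theorem Short.bound_le {L : ℕ} (h : M.Short len L V) :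
    10 + 10 * (M.n * L) + 10 * L + 10 * M.n ≤ V := by
  have := h.le
  nlinarith

section
variable [Field K]

theorem marginExpr_val (hs : M.Loaded s) (p : NatExpr) :
    (marginExpr p).val s = margin M.a M.r (s.num 2) (p.val s) := by
  simp [marginExpr, NumExpr.val, margin, hs.a, hs.r]

theorem len_sum_le (hl : SizeBound sz len) {f : ℕ → K} {b : ℕ} (hf : ∀ x, len (f x) ≤ b)
    (F : Finset ℕ) : len (∑ x ∈ F, f x) ≤ 2 + #F * b := by
  induction F using Finset.induction_on with
  | empty => simpa using hl.zero
  | insert x F hx ih =>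
    rw [sum_insert hx, card_insert_of_notMem hx]
    have := hl.add (f x) (∑ x ∈ F, f x)
    have := hf x
    rw [add_mul, one_mul]
    omega

theorem Short.len_revenueSum_le {L : ℕ} (h : M.Short len L V) (hl : SizeBound sz len) {F : Finset ℕ}
    (hF : F ⊆ range M.n) : len (∑ x ∈ F, M.a x * M.r x) ≤ 2 + M.n * (2 * L) := by
  refine (len_sum_le hl (b := 2 * L) (fun x => ?_) F).trans ?_
  · have := hl.mul (M.a x) (M.r x)
    have := h.a x
    have := h.r x
    omega
  · have := Nat.mul_le_mul_right (2 * L) ((card_le_card hF).trans (card_range M.n).le)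
    omega

theorem Short.len_attractivenessSum_le {L : ℕ} (h : M.Short len L V) (hl : SizeBound sz len)
    {F : Finset ℕ} (hF : F ⊆ range M.n) : len (∑ x ∈ F, M.a x) ≤ 2 + M.n * L := by
  refine (len_sum_le hl h.a F).trans ?_
  have := Nat.mul_le_mul_right L ((card_le_card hF).trans (card_range M.n).le)
  omega

end

variable [Field K] [LinearOrder K]

section
variable (M)

/-- The set `X_k`. -/
def members (k : ℕ) : Finset ℕ :=
  {y ∈ range M.n | ¬ M.a k < M.a y ∧ ¬ 0 < M.dom (k * M.n + y)}

/-- The assortment chosen by the program for `k` and the candidate `lam`. -/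
def choice (k : ℕ) (lam : K) : Finset ℕ := select M.a M.r (M.members k) M.C lam

/-- The candidate for two products. -/
def candidate (i j : ℕ) : K := if M.a j < M.a i then crossing M.a M.r i j else 0

end

theorem memberTest_holds (hs : M.Loaded s) {p : NatExpr} (hp : p.val s < M.n) :
    (memberTest p).Holds s ↔ p.val s ∈ M.members (s.nat 2) := by
  simp [memberTest, Test.Holds, NumExpr.val, NatExpr.val, members, hs.n, hs.a, hs.dom, hp]

theorem beforeTest_holds (hs : M.Loaded s) :
    beforeTest.Holds s ↔
      rankKey M.a M.r (s.num 2) (s.nat 6) < rankKey M.a M.r (s.num 2) (s.nat 5) := by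
  simp only [beforeTest, Test.or, Test.Holds, marginExpr_val hs, NumExpr.val, NatExpr.val, hs.a,
    rankKey_lt_iff]
  generalize margin M.a M.r (s.num 2) (s.nat 5) = u
  generalize margin M.a M.r (s.num 2) (s.nat 6) = v
  generalize M.a (s.nat 5) = b
  generalize M.a (s.nat 6) = c
  -- Programs compare only by `<`, so equalities become two negated comparisons; the rest is
  -- propositional.
  simp only [le_antisymm_iff, ← not_lt]
  tauto

theorem runs_countProg (hl : SizeBound sz len) (hV : M.n ≤ V) (hs : M.Loaded s) :
    Runs sz len V countProg s fun s' =>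
      s'.nat 7 = #{y ∈ M.members (s.nat 2) |
        rankKey M.a M.r (s.num 2) y < rankKey M.a M.r (s.num 2) (s.nat 5)} ∧
      (∀ v < 6, s'.nat v = s.nat v) ∧ s'.natArr = s.natArr ∧ s'.num = s.num ∧
      s'.numArr = s.numArr := by
  classical
  set p : ℕ → Prop := fun y => y ∈ M.members (s.nat 2) ∧
    rankKey M.a M.r (s.num 2) y < rankKey M.a M.r (s.num 2) (s.nat 5) with hp
  refine runs_seq (runs_setNat (by simp [NatExpr.val]) ?_)
  refine runs_forLoop hl (N := M.n) (fun m s' => s'.nat 6 = m ∧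
    s'.nat 7 = #{y ∈ range m | p y} ∧
    (∀ v < 6, s'.nat v = s.nat v) ∧ s'.natArr = s.natArr ∧ s'.num = s.num ∧
    s'.numArr = s.numArr) hV ?_ ?_ ?_ ?_
  · rintro m s' ⟨h6, -, hv, -⟩
    exact ⟨h6, by simp [NatExpr.val, hv 0 (by omega), hs.n]⟩
  · refine ⟨by simp, by simp [NatExpr.val], fun v hv => ?_, rfl, rfl, rfl⟩
    simp [hv.ne, (show v ≠ 7 by omega)]
  · rintro m s' hm ⟨h6, h7, hv, h1, h2, h3⟩
    have hs' : M.Loaded s' := ⟨by rw [hv 0 (by omega), hs.n], by rw [hv 1 (by omega), hs.C],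
      by rw [h1, hs.dom], by rw [h2, hs.a₀], by rw [h3, hs.a], by rw [h3, hs.r]⟩
    have htest : (Test.and (memberTest (.var 6)) beforeTest).Holds s' ↔ p m := by
      rw [Test.Holds, memberTest_holds hs' (by simpa [NatExpr.val, h6] using hm),
        beforeTest_holds hs', h2, h6, hv 2 (by omega), hv 5 (by omega)]
      simp [NatExpr.val, h6, hp]
    have hcard : #{y ∈ range m | p y} ≤ m := (card_filter_le _ _).trans (card_range m).le
    refine runs_ite hl (fun h => ?_) (fun h => ?_)
    · rw [htest] at h
      refine runs_setNat (by simp only [NatExpr.val]; omega)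
        ⟨by simp [h6], by simp, ?_, fun v hv' => ?_, h1, h2, h3⟩
      · rw [range_add_one, filter_insert, if_pos h, card_insert_of_notMem (by simp)]
        simp [NatExpr.val, h7]
      · simp [hv'.ne, (show v ≠ 7 by omega), hv v hv']
    · rw [htest] at h
      refine runs_skip ⟨h6, by simp, ?_, fun v hv' => ?_, h1, h2, h3⟩
      · rw [range_add_one, filter_insert, if_neg h]
        simp [h7]
      · simp [hv'.ne, hv v hv']
  · rintro s' ⟨-, h7, h⟩
    refine ⟨h7.trans ?_, h⟩
    congr 1
    ext y
    simp [hp, members, and_assoc]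

theorem selectTest_holds (hs : M.Loaded s) (h5 : s.nat 5 < M.n)
    (h7 : s.nat 7 = #{y ∈ M.members (s.nat 2) |
      rankKey M.a M.r (s.num 2) y < rankKey M.a M.r (s.num 2) (s.nat 5)}) :
    selectTest.Holds s ↔ s.nat 5 ∈ M.choice (s.nat 2) (s.num 2) := by
  simp only [selectTest, Test.Holds, memberTest_holds hs (p := .var 5) h5, marginExpr_val hs,
    NumExpr.val, NatExpr.val, choice, mem_select_iff, h7, hs.C]

theorem choice_subset (k : ℕ) (lam : K) : M.choice k lam ⊆ range M.n :=
  (select_subset _ _ _ _ _).trans (filter_subset _ _)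

theorem runs_addProg (hl : SizeBound sz len) (hs : M.Loaded s) (hV : 1 ≤ V)
    (h3 : len (s.num 3 + M.a (s.nat 5) * M.r (s.nat 5)) ≤ V)
    (h4 : len (s.num 4 + M.a (s.nat 5)) ≤ V) :
    Runs sz len V addProg s fun s' =>
      s'.nat = s.nat ∧
      (∀ B < 2, s'.natArr B = s.natArr B) ∧
      s'.natArr 2 = Function.update (s.natArr 2) (s.nat 5) 1 ∧
      (∀ v < 3, s'.num v = s.num v) ∧
      s'.num 3 = s.num 3 + M.a (s.nat 5) * M.r (s.nat 5) ∧
      s'.num 4 = s.num 4 + M.a (s.nat 5) ∧ s'.numArr = s.numArr := by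
  refine runs_seq (runs_putNat (by simpa [NatExpr.val] using hV) (runs_seq
    (runs_setNum hl ?_ (runs_setNum hl ?_ ?_))))
  · simpa [NumExpr.val, NatExpr.val, hs.a, hs.r] using h3
  · simpa [NumExpr.val, NatExpr.val, hs.a, hs.r] using h4
  · refine ⟨rfl, fun B hB => ?_, ?_, fun v hv => ?_, ?_, ?_, rfl⟩
    · simp [hB.ne]
    · simp [NatExpr.val]
    · simp [hv.ne, (show v ≠ 4 by omega)]
    · simp [NumExpr.val, NatExpr.val, hs.a, hs.r]
    · simp [NumExpr.val, NatExpr.val, hs.a]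

/-- The target `F` depends only on `k` and the candidate, so membership is decided product by
product. The bound `1` on the cells is carried along so that they can be copied later without
exceeding `V`. -/
theorem runs_selectProg {L : ℕ} (hl : SizeBound sz len) (hM : M.Short len L V) (hs : M.Loaded s) :
    Runs sz len V selectProg s fun s' =>
      (∀ v < 5, s'.nat v = s.nat v) ∧ (∀ B < 2, s'.natArr B = s.natArr B) ∧
      (∀ v < 3, s'.num v = s.num v) ∧ s'.numArr = s.numArr ∧
      (∀ x < M.n, s'.natArr 2 x ≠ 0 ↔ x ∈ M.choice (s.nat 2) (s.num 2)) ∧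
      (∀ x < M.n, s'.natArr 2 x ≤ 1) ∧
      s'.num 3 = ∑ x ∈ M.choice (s.nat 2) (s.num 2), M.a x * M.r x ∧
      s'.num 4 = ∑ x ∈ M.choice (s.nat 2) (s.num 2), M.a x := by
  set F := M.choice (s.nat 2) (s.num 2) with hF
  have hV := hM.bound_le
  have hV0 : 2 ≤ V := by omega
  refine runs_seq (runs_setNum hl (hl.zero.trans hV0) (runs_seq
    (runs_setNum hl (hl.zero.trans hV0) ?_)))
  refine runs_forLoop hl (N := M.n) (fun m s' => s'.nat 5 = m ∧
    (∀ v < 5, s'.nat v = s.nat v) ∧ (∀ B < 2, s'.natArr B = s.natArr B) ∧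
    (∀ v < 3, s'.num v = s.num v) ∧ s'.numArr = s.numArr ∧
    (∀ x < m, s'.natArr 2 x ≠ 0 ↔ x ∈ F) ∧ (∀ x < m, s'.natArr 2 x ≤ 1) ∧
    s'.num 3 = ∑ x ∈ range m with x ∈ F, M.a x * M.r x ∧
    s'.num 4 = ∑ x ∈ range m with x ∈ F, M.a x) (by omega) ?_ ?_ ?_ ?_
  · rintro m s' ⟨h5, hv, -⟩
    exact ⟨h5, by simp [NatExpr.val, hv 0 (by omega), hs.n]⟩
  · refine ⟨by simp, fun v hv => by simp [hv.ne], fun _ _ => rfl, fun v hv => ?_, rfl, by simp,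
      by simp, by simp [NumExpr.val], by simp [NumExpr.val]⟩
    simp [hv.ne, (show v ≠ 4 by omega)]
  · rintro m s' hm ⟨h5, hv, h1, h2, h3, h4, h4', h6, h7⟩
    have hs' : M.Loaded s' := ⟨by rw [hv 0 (by omega), hs.n], by rw [hv 1 (by omega), hs.C],
      by rw [h1 0 (by omega), hs.dom], by rw [h2 0 (by omega), hs.a₀], by rw [h3, hs.a],
      by rw [h3, hs.r]⟩
    refine runs_seq ((runs_countProg hl (by omega) hs').mono fun s1 => ?_)
    rintro ⟨g7, gv, g1, g2, g3⟩
    have hs1 : M.Loaded s1 := ⟨by rw [gv 0 (by omega), hs'.n], by rw [gv 1 (by omega), hs'.C],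
      by rw [g1, hs'.dom], by rw [g2, hs'.a₀], by rw [g3, hs'.a], by rw [g3, hs'.r]⟩
    have e2 : s1.nat 2 = s.nat 2 := by rw [gv 2 (by omega), hv 2 (by omega)]
    have e5 : s1.nat 5 = m := by rw [gv 5 (by omega), h5]
    have el : s1.num 2 = s.num 2 := by rw [g2, h2 2 (by omega)]
    rw [← gv 2 (by omega), ← gv 5 (by omega), ← g2] at g7
    have htest := selectTest_holds hs1 (by omega) g7
    rw [e5, e2, el, ← hF] at htest
    refine runs_ite hl (fun h => ?_) (fun h => ?_)
    · rw [htest] at h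
      have hr : ({x ∈ range (m + 1) | x ∈ F} : Finset ℕ) = insert m {x ∈ range m | x ∈ F} := by
        rw [range_add_one, filter_insert, if_pos h]
      -- Every partial sum runs over at most `M.n` products, so its length is bounded directly by
      -- that of the data.
      have hsub : ({x ∈ range (m + 1) | x ∈ F} : Finset ℕ) ⊆ range M.n :=
        (filter_subset _ _).trans (range_subset_range.2 hm)
      have hn3 : s1.num 3 + M.a (s1.nat 5) * M.r (s1.nat 5) =
          ∑ x ∈ range (m + 1) with x ∈ F, M.a x * M.r x := by
        rw [hr, sum_insert (by simp), e5, g2, h6, add_comm]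
      have hn4 : s1.num 4 + M.a (s1.nat 5) = ∑ x ∈ range (m + 1) with x ∈ F, M.a x := by
        rw [hr, sum_insert (by simp), e5, g2, h7, add_comm]
      have b3 := hM.len_revenueSum_le hl hsub
      have b4 := hM.len_attractivenessSum_le hl hsub
      have hmul : M.n * (2 * L) = 2 * (M.n * L) := by ring
      refine (runs_addProg hl hs1 (by omega) (hn3 ▸ by omega) (hn4 ▸ by omega)).mono fun s2 => ?_
      rintro ⟨k1, k2, k3, k4, k5, k6, k7⟩
      refine ⟨by rw [k1, e5], by simp, fun v hv' => ?_, fun B hB => ?_, fun v hv' => ?_, ?_,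
        fun x hx => ?_, fun x hx => ?_, ?_, ?_⟩
      · simp [hv'.ne, k1, gv v (by omega), hv v hv']
      · simp [k2 B hB, g1, h1 B hB]
      · simp [k4 v hv', g2, h2 v hv']
      · simp [k7, g3, h3]
      · rcases eq_or_ne x m with rfl | hxm
        · simp [k3, e5, h]
        · simp only [k3, e5, Function.update_of_ne hxm, g1]
          exact h4 x (by omega)
      · rcases eq_or_ne x m with rfl | hxm
        · simp [k3, e5]
        · simp only [k3, e5, Function.update_of_ne hxm, g1]
          exact h4' x (by omega)
      · exact k5.trans hn3
      · exact k6.trans hn4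
    · rw [htest] at h
      have hr : ({x ∈ range (m + 1) | x ∈ F} : Finset ℕ) = {x ∈ range m | x ∈ F} := by
        rw [range_add_one, filter_insert, if_neg h]
      refine runs_putNat (by simp [NatExpr.val]) ?_
      refine ⟨e5, by simp, fun v hv' => ?_, fun B hB => ?_, fun v hv' => ?_, ?_,
        fun x hx => ?_, fun x hx => ?_, ?_, ?_⟩
      · simp [hv'.ne, gv v (by omega), hv v hv']
      · simp [hB.ne, g1, h1 B hB]
      · simp [g2, h2 v hv']
      · simp [g3, h3]
      · rcases eq_or_ne x m with rfl | hxm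
        · simp [NatExpr.val, e5, h]
        · simp only [NatExpr.val, e5, Function.update_self, Function.update_of_ne hxm, g1]
          exact h4 x (by omega)
      · rcases eq_or_ne x m with rfl | hxm
        · simp [NatExpr.val, e5]
        · simp only [NatExpr.val, e5, Function.update_self, Function.update_of_ne hxm, g1]
          exact h4' x (by omega)
      · rw [hr, ← h6, ← g2]
      · rw [hr, ← h7, ← g2]
  · rintro s' ⟨-, hv, h1, h2, h3, h4, h4', h6, h7⟩
    have hr : ({x ∈ range M.n | x ∈ F} : Finset ℕ) = F := by
      ext x
      simp only [mem_filter, and_iff_right_iff_imp]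
      exact fun hx => choice_subset _ _ hx
    rw [hr] at h6 h7
    exact ⟨hv, h1, h2, h3, h4, h4', h6, h7⟩

theorem runs_candidateProg {L : ℕ} (hl : SizeBound sz len) (hM : M.Short len L V)
    (hs : M.Loaded s) :
    Runs sz len V candidateProg s fun s' =>
      s' = { s with num := Function.update s.num 2 (M.candidate (s.nat 3) (s.nat 4)) } := by
  have hV := hM.bound_le
  have hiff : (Test.numLt (.get 0 (.var 4)) (.get 0 (.var 3))).Holds s ↔
      M.a (s.nat 4) < M.a (s.nat 3) := by
    simp [Test.Holds, NumExpr.val, NatExpr.val, hs.a]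
  refine runs_ite hl (fun h => ?_) (fun h => ?_) <;> rw [hiff] at h
  · refine runs_setNum hl ?_ ?_
    · have := hM.a (s.nat 3)
      have := hM.a (s.nat 4)
      have := hM.r (s.nat 3)
      have := hM.r (s.nat 4)
      have := hl.mul (M.a (s.nat 3)) (M.r (s.nat 3))
      have := hl.mul (M.a (s.nat 4)) (M.r (s.nat 4))
      have := hl.sub (M.a (s.nat 3)) (M.a (s.nat 4))
      have := hl.sub (M.a (s.nat 3) * M.r (s.nat 3)) (M.a (s.nat 4) * M.r (s.nat 4))
      simp only [NumExpr.val, NatExpr.val, hs.a, hs.r]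
      refine (hl.div _ _).trans ?_
      omega
    · simp [candidate, h, crossing, NumExpr.val, NatExpr.val, hs.a, hs.r]
  · exact runs_setNum hl (hl.zero.trans (by omega)) (by simp [candidate, h, NumExpr.val])

variable (M) in
/-- The store holds an assortment of at most `C` products of some `X_k` and its revenue. -/
structure HoldsBest (s : Store K) : Prop where
  subset : ∃ k < M.n, {x ∈ range M.n | s.natArr 1 x ≠ 0} ⊆ M.members k
  card_le : #{x ∈ range M.n | s.natArr 1 x ≠ 0} ≤ M.C
  best : s.num 1 = revenue M.a M.r M.a₀ {x ∈ range M.n | s.natArr 1 x ≠ 0}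

variable [IsStrictOrderedRing K]

theorem runs_updateProg {L : ℕ} (hl : SizeBound sz len) (hM : M.Short len L V) (hs : M.Loaded s)
    {F : Finset ℕ} (hF : F ⊆ range M.n) (hpos : ∀ x ∈ F, 0 ≤ M.a x) (h₀ : 0 ≤ M.a₀)
    (harr : ∀ x < M.n, s.natArr 2 x ≠ 0 ↔ x ∈ F) (harr' : ∀ x < M.n, s.natArr 2 x ≤ 1)
    (h3 : s.num 3 = ∑ x ∈ F, M.a x * M.r x) (h4 : s.num 4 = ∑ x ∈ F, M.a x)
    (hbest : 0 ≤ s.num 1) :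
    Runs sz len V updateProg s fun s' =>
      M.Loaded s' ∧ (∀ v < 5, s'.nat v = s.nat v) ∧ s.num 1 ≤ s'.num 1 ∧
      revenue M.a M.r M.a₀ F ≤ s'.num 1 ∧
      (s'.num 1 = s.num 1 ∧ s'.natArr 1 = s.natArr 1 ∨
        s'.num 1 = revenue M.a M.r M.a₀ F ∧ ({x ∈ range M.n | s'.natArr 1 x ≠ 0} : Finset ℕ) = F) := by
  have hV := hM.bound_le
  have hmul : M.n * (2 * L) = 2 * (M.n * L) := by ring
  have hden : 0 ≤ ∑ x ∈ F, M.a x + M.a₀ := add_nonneg (sum_nonneg hpos) h₀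
  have hiff : (Test.numLt (.mul (.var 1) (.add (.var 4) (.var 0))) (.var 3)).Holds s ↔
      s.num 1 * (∑ x ∈ F, M.a x + M.a₀) < ∑ x ∈ F, M.a x * M.r x := by
    simp [Test.Holds, NumExpr.val, h3, h4, hs.a₀]
  refine runs_ite hl (fun h => ?_) (fun h => ?_) <;> rw [hiff] at h
  · have hval : (NumExpr.div (.var 3) (.add (.var 4) (.var 0))).val s =
        revenue M.a M.r M.a₀ F := by
      simp [NumExpr.val, h3, h4, hs.a₀, revenue]
    have hlt : s.num 1 ≤ revenue M.a M.r M.a₀ F := by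
      -- If the denominator is zero, all attractivenesses in `F` vanish and so does the numerator;
      -- the strict test then fails, so no division by zero is reached.
      rcases hden.eq_or_lt with hd | hd
      · rw [← hd, mul_zero] at h
        have hz : ∀ x ∈ F, M.a x = 0 := (sum_eq_zero_iff_of_nonneg hpos).1
          (le_antisymm (by linarith) (sum_nonneg hpos))
        rw [sum_eq_zero fun x hx => by rw [hz x hx, zero_mul]] at h
        exact absurd h (lt_irrefl _)
      · exact (le_div_iff₀ hd).2 h.le
    refine runs_seq (runs_setNum hl ?_ ?_) <;> rw [hval]
    · have := hM.len_revenueSum_le hl hF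
      have := hM.len_attractivenessSum_le hl hF
      have := hl.add (∑ x ∈ F, M.a x) M.a₀
      have := hM.a₀
      refine (hl.div _ _).trans ?_
      omega
    · refine runs_forLoop hl (N := M.n) (fun m s' => s'.nat 5 = m ∧ M.Loaded s' ∧
        (∀ v < 5, s'.nat v = s.nat v) ∧ s'.num 1 = revenue M.a M.r M.a₀ F ∧
        s'.natArr 2 = s.natArr 2 ∧ ∀ x < m, s'.natArr 1 x = s.natArr 2 x) (by omega) ?_ ?_ ?_ ?_
      · rintro m s' ⟨h5, hs', -⟩
        exact ⟨h5, by simp [NatExpr.val, hs'.n]⟩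
      · refine ⟨by simp, ⟨?_, ?_, ?_, ?_, ?_, ?_⟩, fun v hv => ?_, by simp, rfl, by simp⟩
        · simp [hs.n]
        · simp [hs.C]
        · simp [hs.dom]
        · simp [hs.a₀]
        · simp [hs.a]
        · simp [hs.r]
        · simp [hv.ne]
      · rintro m s' hm ⟨h5, hs', hv, h1, h2, hc⟩
        have := harr' m hm
        refine runs_putNat (by simp only [NatExpr.val, h5, h2]; omega) ?_
        refine ⟨h5, by simp, ⟨?_, ?_, ?_, ?_, ?_, ?_⟩, fun v hv' => ?_, by simp [h1], by simp [h2],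
          fun x hx => ?_⟩
        · simp [hs'.n]
        · simp [hs'.C]
        · simp [hs'.dom]
        · simp [hs'.a₀]
        · simp [hs'.a]
        · simp [hs'.r]
        · simp [hv'.ne, hv v hv']
        · rcases eq_or_ne x m with rfl | hxm
          · simp [NatExpr.val, h5, h2]
          · simp [NatExpr.val, h5, hxm, hc x (by omega)]
      · rintro s' ⟨-, hs', hv, h1, h2, hc⟩
        refine ⟨hs', hv, h1 ▸ hlt, h1.ge, Or.inr ⟨h1, ?_⟩⟩
        ext x
        simp only [mem_filter, mem_range]
        constructor
        · rintro ⟨hx, hne⟩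
          exact (harr x hx).1 (hc x hx ▸ hne)
        · intro hx
          have hxn := mem_range.1 (hF hx)
          exact ⟨hxn, hc x hxn ▸ (harr x hxn).2 hx⟩
  · refine runs_skip ⟨hs, fun _ _ => rfl, le_rfl, ?_, Or.inl ⟨rfl, rfl⟩⟩
    -- This covers a zero denominator too: the revenue is then `0`, which `hbest` bounds.
    exact div_le_of_le_mul₀ hden hbest (not_lt.1 h)

variable (M) in
/-- The hypotheses on the data under which the program is correct. -/
structure Valid : Prop where
  a_pos : ∀ x < M.n, 0 < M.a x
  a₀ : 0 ≤ M.a₀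
  r : ∀ x < M.n, 0 ≤ M.r x
  a_dummy : M.a M.n = 0
  r_dummy : M.r M.n = 0

theorem HoldsBest.nonneg (hM : M.Valid) (hb : M.HoldsBest s) : 0 ≤ s.num 1 := by
  rw [hb.best]
  exact revenue_nonneg (fun i hi => (hM.a_pos i (mem_range.1 (mem_filter.1 hi).1)).le)
    (fun i hi => hM.r i (mem_range.1 (mem_filter.1 hi).1)) hM.a₀

/-- One candidate. -/
theorem runs_step {L : ℕ} (hl : SizeBound sz len) (hM : M.Short len L V) (hM' : M.Valid)
    (hs : M.Loaded s) (hb : M.HoldsBest s) (hk : s.nat 2 < M.n) :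
    Runs sz len V (.seq candidateProg (.seq selectProg updateProg)) s fun s' =>
      M.Loaded s' ∧ M.HoldsBest s' ∧ (∀ v < 5, s'.nat v = s.nat v) ∧ s.num 1 ≤ s'.num 1 ∧
      revenue M.a M.r M.a₀ (M.choice (s.nat 2) (M.candidate (s.nat 3) (s.nat 4))) ≤ s'.num 1 := by
  refine runs_seq ((runs_candidateProg hl hM hs).mono ?_)
  rintro s1 hs1
  have l1 : M.Loaded s1 := by
    subst hs1
    exact ⟨hs.n, hs.C, hs.dom, by simp [hs.a₀], hs.a, hs.r⟩
  have hF : M.choice (s1.nat 2) (s1.num 2) =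
      M.choice (s.nat 2) (M.candidate (s.nat 3) (s.nat 4)) := by subst hs1; simp
  have hn1 : s1.nat = s.nat := by subst hs1; rfl
  have ha1 : s1.natArr = s.natArr := by subst hs1; rfl
  have hb1 : s1.num 1 = s.num 1 := by subst hs1; simp
  refine runs_seq ((runs_selectProg hl hM l1).mono ?_)
  rw [hF]
  rintro s2 ⟨g1, g2, g3, g4, g5, g6, g7, g8⟩
  have l2 : M.Loaded s2 := ⟨by rw [g1 0 (by omega), l1.n], by rw [g1 1 (by omega), l1.C],
    by rw [g2 0 (by omega), l1.dom], by rw [g3 0 (by omega), l1.a₀], by rw [g4, l1.a],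
    by rw [g4, l1.r]⟩
  have e1 : s2.num 1 = s.num 1 := by rw [g3 1 (by omega), hb1]
  have e2 : s2.natArr 1 = s.natArr 1 := by rw [g2 1 (by omega), ha1]
  have hsub := choice_subset (M := M) (s.nat 2) (M.candidate (s.nat 3) (s.nat 4))
  refine (runs_updateProg hl hM l2 hsub (fun x hx => (hM'.a_pos x (mem_range.1 (hsub hx))).le)
    hM'.a₀ g5 g6 g7 g8 (e1 ▸ hb.nonneg hM')).mono ?_
  rintro s3 ⟨k1, k2, k3, k4, k5⟩
  refine ⟨k1, ?_, fun v hv => by rw [k2 v hv, g1 v hv, hn1], e1 ▸ k3, k4⟩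
  rcases k5 with ⟨k5, k6⟩ | ⟨k5, k6⟩
  · rw [e1] at k5
    rw [e2] at k6
    exact ⟨k6 ▸ hb.subset, k6 ▸ hb.card_le, k5 ▸ k6 ▸ hb.best⟩
  · exact ⟨⟨s.nat 2, hk, k6 ▸ select_subset _ _ _ _ _⟩, k6 ▸ card_select_le _ _ _ _ _,
      k6 ▸ k5⟩

end ProgData

end CapacitatedMNL

/-! ### The nested loops over `k` and the pairs defining a candidate -/

namespace CapacitatedMNL

open Finset RAM

namespace ProgData

theorem Loaded.setNat {K : Type} {M : ProgData K} {s : Store K} (hs : M.Loaded s) {x : ℕ}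
    (hx : 2 ≤ x) (m : ℕ) :
    M.Loaded { s with nat := Function.update s.nat x m } where
  n := by simp [hs.n, (show 0 ≠ x by omega)]
  C := by simp [hs.C, (show 1 ≠ x by omega)]
  dom := hs.dom
  a₀ := hs.a₀
  a := hs.a
  r := hs.r

variable {K : Type} [Field K] [LinearOrder K] {M : ProgData K} {s : Store K}
  {sz len : K → ℕ} {V : ℕ}

theorem HoldsBest.setNat (hs : M.HoldsBest s) (x m : ℕ) :
    M.HoldsBest { s with nat := Function.update s.nat x m } :=
  ⟨hs.subset, hs.card_le, hs.best⟩

variable (M) in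
/-- From `s` to `s'` the best revenue has not decreased and has become an upper bound of `D`, and the
variables below `x` are unchanged. -/
structure Improved (x : ℕ) (D : Set K) (s s' : Store K) : Prop where
  loaded : M.Loaded s'
  holdsBest : M.HoldsBest s'
  nat : ∀ v < x, s'.nat v = s.nat v
  mono : s.num 1 ≤ s'.num 1
  le : ∀ c ∈ D, c ≤ s'.num 1

/-- Body and loop have postconditions of the same shape, so loops can be nested. Since the best
revenue never decreases, the bounds reached in earlier rounds persist. -/
theorem runs_forLoop_improved (hl : SizeBound sz len) {x N : ℕ} {e : NatExpr} {P : Prog}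
    (hx : 2 ≤ x) (hN : N ≤ V) (D : ℕ → Set K) (hs : M.Loaded s) (hb : M.HoldsBest s)
    (he : ∀ s', M.Loaded s' → e.val s' = N)
    (hP : ∀ m < N, ∀ s', M.Loaded s' → M.HoldsBest s' → (∀ v < x, s'.nat v = s.nat v) →
      s'.nat x = m → Runs sz len V P s' (M.Improved (x + 1) (D m) s')) :
    Runs sz len V (forLoop x e P) s (M.Improved x {c | ∃ m < N, c ∈ D m} s) := by
  refine runs_forLoop hl (N := N)
    (fun m s' => s'.nat x = m ∧ M.Improved x {c | ∃ i < m, c ∈ D i} s s') hN ?_ ?_ ?_ ?_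
  · rintro m s' ⟨h, hs'⟩
    exact ⟨h, he s' hs'.loaded⟩
  · exact ⟨by simp, hs.setNat hx 0, hb.setNat x 0, fun v hv => by simp [hv.ne], le_rfl, by simp⟩
  · rintro m s' hm ⟨h, hs'⟩
    refine (hP m hm s' hs'.loaded hs'.holdsBest hs'.nat h).mono fun s'' hs'' => ?_
    refine ⟨by rw [hs''.nat x (by omega), h], by simp, hs''.loaded.setNat hx _,
      hs''.holdsBest.setNat x _, fun v hv => ?_, hs'.mono.trans hs''.mono, ?_⟩
    · simp [hv.ne, hs''.nat v (by omega), hs'.nat v hv]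
    · rintro c ⟨i, hi, hc⟩
      rcases (Nat.lt_succ_iff.1 hi).lt_or_eq with hi | rfl
      · exact (hs'.le c ⟨i, hi, hc⟩).trans hs''.mono
      · exact hs''.le c hc
  · rintro s' ⟨-, h⟩
    exact h

variable [IsStrictOrderedRing K]

theorem runs_assortmentProg {L : ℕ} (hl : SizeBound sz len) (hM : M.Short len L V)
    (hM' : M.Valid) (hs : M.Loaded s) (hb : M.HoldsBest s) :
    Runs sz len V assortmentProg s fun s' => M.HoldsBest s' ∧
      ∀ k < M.n, ∀ i < M.n + 1, ∀ j < M.n + 1,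
        revenue M.a M.r M.a₀ (M.choice k (M.candidate i j)) ≤ s'.num 1 := by
  have hV := hM.n_lt
  have hn : ∀ s' : Store K, M.Loaded s' → (NatExpr.var 0).val s' = M.n := fun s' hs' => hs'.n
  have hn1 : ∀ s' : Store K, M.Loaded s' →
      (NatExpr.add (.var 0) (.const 1)).val s' = M.n + 1 := fun s' hs' => by
    simp [NatExpr.val, hs'.n]
  refine (runs_forLoop_improved hl le_rfl (by omega) (fun k => {c | ∃ i < M.n + 1,
    c ∈ {c | ∃ j < M.n + 1, c ∈ ({revenue M.a M.r M.a₀ (M.choice k (M.candidate i j))} : Set K)}})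
    hs hb hn ?_).mono
    fun s' hs' => ⟨hs'.holdsBest, fun k hk i hi j hj => hs'.le _ ⟨k, hk, i, hi, j, hj, rfl⟩⟩
  intro k hk s1 hs1 hb1 _ h2
  refine runs_forLoop_improved hl (by omega) hV _ hs1 hb1 hn1 ?_
  intro i hi s2 hs2 hb2 hv2 h3
  refine runs_forLoop_improved hl (by omega) hV _ hs2 hb2 hn1 ?_
  intro j hj s3 hs3 hb3 hv3 h4
  have e2 : s3.nat 2 = k := by rw [hv3 2 (by omega), hv2 2 (by omega), h2]
  have e3 : s3.nat 3 = i := by rw [hv3 3 (by omega), h3]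
  refine (runs_step hl hM hM' hs3 hb3 (e2 ▸ hk)).mono ?_
  rintro s4 ⟨k1, k2, k3, k4, k5⟩
  rw [e2, e3, h4] at k5
  exact ⟨k1, k2, k3, k4, by rintro c rfl; exact k5⟩

/-- Index `M.n` acts as a dummy product of attractiveness and revenue zero. Its crossing with `i` is
`r i`, and equal indices give `0`, so pairs of indices up to `M.n` produce every breakpoint. -/
theorem exists_candidate (hM : M.Valid) (k : ℕ) :
    ∃ i < M.n + 1, ∃ j < M.n + 1, ∀ T ⊆ M.members k, #T ≤ M.C →
      revenue M.a M.r M.a₀ T ≤ revenue M.a M.r M.a₀ (M.choice k (M.candidate i j)) := by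
  have hlt : ∀ i ∈ M.members k, i < M.n := fun i hi => mem_range.1 (mem_filter.1 hi).1
  have hmem : ∀ i < M.n + 1, ∀ j < M.n + 1, M.candidate i j ∈
      (range (M.n + 1) ×ˢ range (M.n + 1)).image fun p => M.candidate p.1 p.2 := fun i hi j hj =>
    mem_image.2 ⟨(i, j), mem_product.2 ⟨mem_range.2 hi, mem_range.2 hj⟩, rfl⟩
  obtain ⟨lam, hlam, h⟩ := exists_revenue_le_revenue_select (C := M.C) (a₀ := M.a₀)
    (cand := (range (M.n + 1) ×ˢ range (M.n + 1)).image fun p => M.candidate p.1 p.2)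
    (fun i hi => hM.a_pos i (hlt i hi)) (fun i hi => hM.r i (hlt i hi)) hM.a₀
    (by simpa [candidate] using hmem 0 (by omega) 0 (by omega))
    (fun i hi => by
      have hi' := hM.a_pos i (hlt i hi)
      have := hmem i (by have := hlt i hi; omega) M.n (by omega)
      rwa [candidate, hM.a_dummy, if_pos hi', crossing, hM.a_dummy, zero_mul, sub_zero, sub_zero,
        mul_div_cancel_left₀ _ hi'.ne'] at this)
    (fun i hi j hj hij => by
      have := hmem i (by have := hlt i hi; omega) j (by have := hlt j hj; omega)
      rwa [candidate, if_pos hij] at this)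
  obtain ⟨p, hp, rfl⟩ := mem_image.1 hlam
  rw [mem_product, mem_range, mem_range] at hp
  exact ⟨p.1, hp.1, p.2, hp.2, h⟩

end ProgData

end CapacitatedMNL

/-! ## The reduction to multinomial logit problems -/

namespace C2SLM

variable {K : Type} [Field K] [LinearOrder K] {M : C2SLM K}

theorem mem_X {k i : Fin M.n} : i ∈ M.X k ↔ M.a i ≤ M.a k ∧ ¬ M.dom k i := by simp [X]

/-- The product `k` inherits whatever a product of `X k` dominates: by correlation if `k` is
strictly more attractive, by tie consistency if equally so. -/
theorem dominanceFree_X (h : M.AttractivenessCorrelated) (h' : M.TieConsistent) (k : Fin M.n) :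
    M.DominanceFree (M.X k) := by
  intro x hx y hy hxy
  rw [mem_X] at hx hy
  rcases hx.1.lt_or_eq with hlt | heq
  · exact hy.2 (h.2 x y k hxy hlt)
  · exact hy.2 (h' x y k hxy heq.symm)

theorem DominanceFree.mono {S T : Finset (Fin M.n)} (hT : M.DominanceFree T) (h : S ⊆ T) :
    M.DominanceFree S :=
  fun x hx y hy => hT x (h hx) y (h hy)

theorem DominanceFree.exists_subset_X {S : Finset (Fin M.n)} (hS : M.DominanceFree S) :
    ∃ k, S ⊆ M.X k := by
  rcases S.eq_empty_or_nonempty with rfl | hne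
  -- The empty set fits any `k`; one exists because `1 ≤ C ≤ n`.
  · exact ⟨⟨0, M.one_le_C.trans M.C_le_n⟩, Finset.empty_subset _⟩
  · obtain ⟨k, hk, hmax⟩ := Finset.exists_max_image S M.a hne
    exact ⟨k, fun i hi => mem_X.2 ⟨hmax i hi, hS k hk i hi⟩⟩

theorem exists_isOptimal (M : C2SLM K) : ∃ S, M.IsOptimal S := by
  classical
  obtain ⟨S, hS, hmax⟩ := Finset.exists_max_image (Finset.univ.filter M.Feasible)
    M.expectedRevenue ⟨∅, by simp [Feasible, DominanceFree]⟩
  simp only [Finset.mem_filter, Finset.mem_univ, true_and] at hS hmax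
  exact ⟨S, hS, hmax⟩

/-- An assortment within some `X_k` is optimal if its multinomial logit revenue is the largest
within all `X_j`. -/
theorem isOptimal_of_mnlRevenue (h : M.AttractivenessCorrelated) (h' : M.TieConsistent)
    {S : Finset (Fin M.n)} {k : Fin M.n} (hS : S ⊆ M.X k) (hC : S.card ≤ M.C)
    (hmax : ∀ j, ∀ T ⊆ M.X j, T.card ≤ M.C → M.mnlRevenue T ≤ M.mnlRevenue S) :
    M.IsOptimal S := by
  have hdf := (dominanceFree_X h h' k).mono hS
  refine ⟨⟨hdf, hC⟩, fun T hT => ?_⟩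
  obtain ⟨j, hj⟩ := hT.1.exists_subset_X
  rw [M.expectedRevenue_eq_mnlRevenue hdf, M.expectedRevenue_eq_mnlRevenue hT.1]
  exact hmax j T hj hT.2

/-! ## The program on the instances -/

open RAM CapacitatedMNL

variable (M) in
/-- The data of an instance, as they are stored. -/
noncomputable def progData : ProgData K where
  n := M.n
  C := M.C
  a := M.input.numArr 0
  r := M.input.numArr 1
  a₀ := M.a₀
  dom := M.input.natArr 0

theorem progData_a (i : Fin M.n) : M.progData.a i = M.a i := by simp [progData, input]

theorem progData_r (i : Fin M.n) : M.progData.r i = M.r i := by simp [progData, input]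

theorem progData_dom (k i : Fin M.n) : 0 < M.progData.dom (k * M.n + i) ↔ M.dom k i := by
  have key : (∃ k' i' : Fin M.n, (k : ℕ) * M.n + i = k' * M.n + i' ∧ M.dom k' i') ↔
      M.dom k i := by
    refine ⟨?_, fun h => ⟨k, i, rfl, h⟩⟩
    rintro ⟨k', i', he, h⟩
    have hpos : 0 < M.n := k.pos
    -- Quotient and remainder modulo `M.n` recover row and column from the address.
    have hk := congrArg (· / M.n) he
    have hi := congrArg (· % M.n) he
    simp only [Nat.mul_add_mod', Nat.mod_eq_of_lt i.2, Nat.mod_eq_of_lt i'.2] at hi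
    simp only [mul_comm _ M.n, Nat.mul_add_div hpos, Nat.div_eq_of_lt i.2,
      Nat.div_eq_of_lt i'.2, add_zero] at hk
    rwa [Fin.ext hk, Fin.ext hi]
  simp only [progData, input]
  split_ifs with h
  · simp [key.1 h.2]
  · simpa using fun hd => h ⟨rfl, key.2 hd⟩

theorem mem_members_progData {k i : Fin M.n} : (i : ℕ) ∈ M.progData.members k ↔ i ∈ M.X k := by
  have hn : M.progData.n = M.n := rfl
  rw [ProgData.members, Finset.mem_filter, mem_X, hn, progData_dom, progData_a, progData_a, not_lt]
  simp

theorem revenue_map (S : Finset (Fin M.n)) :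
    revenue M.progData.a M.progData.r M.progData.a₀ (S.map Fin.valEmbedding) = M.mnlRevenue S := by
  simp only [revenue, mnlRevenue, Finset.sum_map, Fin.valEmbedding_apply, progData_a, progData_r,
    mul_comm (M.a _)]
  rfl

theorem map_output (s : Store K) : (M.output s).map Fin.valEmbedding =
    {x ∈ Finset.range M.progData.n | s.natArr 1 x ≠ 0} := by
  ext x
  simp only [output, Finset.mem_map, Finset.mem_filter, Finset.mem_univ, true_and,
    Fin.valEmbedding_apply, Finset.mem_range]
  constructor
  · rintro ⟨i, hi, rfl⟩
    exact ⟨i.2, hi⟩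
  · rintro ⟨hx, h⟩
    exact ⟨⟨x, hx⟩, h, rfl⟩

theorem loaded_input (M : C2SLM K) : M.progData.Loaded M.input where
  n := by simp [progData, input]
  C := by simp [progData, input]
  dom := rfl
  a₀ := by simp [progData, input]
  a := rfl
  r := rfl

theorem valid_progData (M : C2SLM K) : M.progData.Valid where
  a_pos x hx := by simpa [progData_a] using progData_a (M := M) ⟨x, hx⟩ ▸ M.a_pos ⟨x, hx⟩
  a₀ := M.a₀_nonneg
  r x hx := by simpa [progData_r] using progData_r (M := M) ⟨x, hx⟩ ▸ M.r_nonneg ⟨x, hx⟩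
  a_dummy := by simp [progData, input]
  r_dummy := by simp [progData, input]

/-- The zeros of the initial store encode the empty assortment and its revenue, which starts the
invariant. -/
theorem holdsBest_input (M : C2SLM K) : M.progData.HoldsBest M.input := by
  have h : ({x ∈ Finset.range M.progData.n | M.input.natArr 1 x ≠ 0} : Finset ℕ) = ∅ := by
    simp [input]
  exact ⟨⟨0, M.one_le_C.trans M.C_le_n, by simp [h]⟩, by simp [h], by simp [revenue, input]⟩

/-! ### Length of the input and total running time -/

section
variable {len : K → ℕ} {L V : ℕ}

theorem len_numArr_input_le (h0 : len 0 ≤ L) (ha : ∀ i, len (M.a i) ≤ L)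
    (hr : ∀ i, len (M.r i) ≤ L) (A p : ℕ) : len (M.input.numArr A p) ≤ L := by
  simp only [input]
  split_ifs
  exacts [ha _, hr _, h0, h0]

theorem bounded_input (hV : M.n ≤ V) (hL : L ≤ V) (h0 : len 0 ≤ L) (ha : ∀ i, len (M.a i) ≤ L)
    (hr : ∀ i, len (M.r i) ≤ L) (h₀ : len M.a₀ ≤ L) : M.input.Bounded len V where
  nat x := by
    have := M.C_le_n
    simp only [input]
    split_ifs <;> omega
  natArr A p := by
    have := M.one_le_C.trans M.C_le_n
    simp only [input]
    split_ifs <;> omega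
  num x := by
    simp only [input]
    split_ifs
    exacts [h₀.trans hL, h0.trans hL]
  numArr A p := (len_numArr_input_le h0 ha hr A p).trans hL

variable [IsStrictOrderedRing K] {sz : K → ℕ}

/-- The final assortment attains the stored revenue, which is at least the optimum of every `X j`,
because one of the candidates tried solves the problem on `X j`. -/
theorem exists_exec_assortmentProg (hl : SizeBound sz len) (h : M.AttractivenessCorrelated)
    (h' : M.TieConsistent) (h0 : 2 ≤ L) (ha : ∀ i, len (M.a i) ≤ L) (hr : ∀ i, len (M.r i) ≤ L)
    (h₀ : len M.a₀ ≤ L) (hV : 10 * ((M.n + 1) * (L + 1)) ≤ V) :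
    ∃ (s : Store K) (t : ℕ), Exec sz assortmentProg M.input s t ∧
      t ≤ assortmentProg.costPoly.eval V ∧ M.IsOptimal (M.output s) := by
  have h0' : len 0 ≤ L := hl.zero.trans h0
  have hbd : M.input.Bounded len V :=
    bounded_input (by nlinarith) (by nlinarith) h0' ha hr h₀
  have hshort : M.progData.Short len L V :=
    ⟨len_numArr_input_le h0' ha hr 0, len_numArr_input_le h0' ha hr 1, h₀, hV⟩
  obtain ⟨s, t, hex, ht, -, hbest, hmax⟩ := ProgData.runs_assortmentProg hl hshort
    M.valid_progData M.loaded_input M.holdsBest_input hbd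
  refine ⟨s, t, hex, ht, ?_⟩
  obtain ⟨⟨k, hk, hsub⟩, hcard, hnum⟩ := hbest
  rw [← map_output] at hsub hcard hnum
  rw [revenue_map] at hnum
  rw [Finset.card_map] at hcard
  refine isOptimal_of_mnlRevenue h h' (k := ⟨k, hk⟩) (fun i hi => ?_) hcard fun j T hT hTC => ?_
  · exact mem_members_progData.1 (hsub (Finset.mem_map_of_mem Fin.valEmbedding hi))
  · obtain ⟨i, hi, i', hi', hle⟩ := ProgData.exists_candidate M.valid_progData j
    rw [← hnum, ← revenue_map]
    refine (hle _ (fun x hx => ?_) ((Finset.card_map _).trans_le hTC)).trans (hmax j j.2 i hi i' hi')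
    obtain ⟨y, hy, rfl⟩ := Finset.mem_map.1 hx
    exact mem_members_progData.2 (hT hy)

end

theorem n_le_bitLength (M : C2SLM ℚ) : M.n ≤ M.bitLength := by
  have := Nat.le_mul_self M.n
  simp only [bitLength]
  omega

theorem bitSize_a₀_le_bitLength (M : C2SLM ℚ) : bitSize M.a₀ ≤ M.bitLength := by
  simp only [bitLength]
  omega

theorem bitSize_add_bitSize_le_bitLength (M : C2SLM ℚ) (i : Fin M.n) :
    bitSize (M.a i) + bitSize (M.r i) ≤ M.bitLength := by
  have := Finset.single_le_sum (f := fun i => bitSize (M.a i) + bitSize (M.r i))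
    (fun _ _ => Nat.zero_le _) (Finset.mem_univ i)
  simp only [bitLength] at this ⊢
  omega

theorem exists_exec_unitSize (M : C2SLM ℝ) (h : M.AttractivenessCorrelated)
    (h' : M.TieConsistent) :
    ∃ (s : Store ℝ) (t : ℕ), Exec unitSize assortmentProg M.input s t ∧
      t ≤ (assortmentProg.costPoly.comp (10 * ((Polynomial.X + 1) * 3))).eval M.n ∧
      M.IsOptimal (M.output s) := by
  simpa [Polynomial.eval_comp] using
    -- All lengths are `1`, but `L` must be at least `2`, the bound that `SizeBound` grants for the
    -- constant zero.
    exists_exec_assortmentProg (L := 2) (V := 10 * ((M.n + 1) * 3)) sizeBound_unitSize h h' le_rfl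
      (fun _ => one_le_two) (fun _ => one_le_two) one_le_two le_rfl

theorem exists_exec_bitSize (M : C2SLM ℚ) (h : M.AttractivenessCorrelated)
    (h' : M.TieConsistent) :
    ∃ (s : Store ℚ) (t : ℕ), Exec bitSize assortmentProg M.input s t ∧
      t ≤ (assortmentProg.costPoly.comp
        (10 * ((Polynomial.X + 1) * (Polynomial.X + 3)))).eval M.bitLength ∧
      M.IsOptimal (M.output s) := by
  have hai := M.bitSize_add_bitSize_le_bitLength
  -- The data need only `M.bitLength + 1`; one more makes `2 ≤ L` immediate.
  have ha (i) : ratLen (M.a i) ≤ M.bitLength + 2 :=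
    (ratLen_le_bitSize _).trans (by have := hai i; omega)
  have hr (i) : ratLen (M.r i) ≤ M.bitLength + 2 :=
    (ratLen_le_bitSize _).trans (by have := hai i; omega)
  have h₀ : ratLen M.a₀ ≤ M.bitLength + 2 :=
    (ratLen_le_bitSize _).trans (by have := M.bitSize_a₀_le_bitLength; omega)
  simpa [Polynomial.eval_comp] using
    exists_exec_assortmentProg (V := 10 * ((M.bitLength + 1) * (M.bitLength + 3)))
      sizeBound_bitSize h h' (by omega) ha hr h₀
      (Nat.mul_le_mul_left _ (Nat.mul_le_mul_right _ (Nat.succ_le_succ M.n_le_bitLength)))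

end C2SLM

theorem mainTheorem4 :
    -- the problem is solved by one program, in polynomially many arithmetic operations for real
    -- data, and in polynomial time in the bit model for rational data
    (∃ P : RAM.Prog,
      (∃ p : Polynomial ℕ, ∀ M : C2SLM ℝ, M.AttractivenessCorrelated → M.TieConsistent →
        ∃ (s : RAM.Store ℝ) (t : ℕ), RAM.Exec RAM.unitSize P M.input s t ∧
          t ≤ p.eval M.n ∧ M.IsOptimal (M.output s)) ∧
      (∃ q : Polynomial ℕ, ∀ M : C2SLM ℚ, M.AttractivenessCorrelated → M.TieConsistent →
        ∃ (s : RAM.Store ℚ) (t : ℕ), RAM.Exec RAM.bitSize P M.input s t ∧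
          t ≤ q.eval M.bitLength ∧ M.IsOptimal (M.output s))) ∧
    -- the reduction to the multinomial logit problems on the sets `X_k`
    (∀ M : C2SLM ℝ, M.AttractivenessCorrelated → M.TieConsistent →
      (∀ k, M.DominanceFree (M.X k)) ∧
      (∃ k S, S ⊆ M.X k ∧ M.IsOptimal S) ∧
      (∀ S, M.IsOptimal S → ∃ k, S ⊆ M.X k) ∧
      (∀ k S, S ⊆ M.X k → M.expectedRevenue S = M.mnlRevenue S) ∧
      (∀ T : Fin M.n → Finset (Fin M.n), (∀ k, M.IsMNLOptimal (M.X k) (T k)) →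
        ∀ k, (∀ j, M.mnlRevenue (T j) ≤ M.mnlRevenue (T k)) → M.IsOptimal (T k))) := by
  refine ⟨⟨RAM.assortmentProg, ⟨_, C2SLM.exists_exec_unitSize⟩, ⟨_, C2SLM.exists_exec_bitSize⟩⟩,
    fun M h h' => ⟨C2SLM.dominanceFree_X h h', ?_, fun S hS => hS.1.1.exists_subset_X,
      fun k S hS => M.expectedRevenue_eq_mnlRevenue ((C2SLM.dominanceFree_X h h' k).mono hS),
      fun T hT k hk => C2SLM.isOptimal_of_mnlRevenue h h' (hT k).1.1 (hT k).1.2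
        fun j S hS hC => ((hT j).2 S hS hC).trans (hk j)⟩⟩
  obtain ⟨S, hS⟩ := M.exists_isOptimal
  obtain ⟨k, hk⟩ := hS.1.1.exists_subset_X
  exact ⟨k, S, hk, hS⟩
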